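/- **Theorem 1 (findsol).** Let $F : D \to \{0,1\}$ be a function on a finite domain of size $N\ge 1$, given as a quantum oracle $|x,b\rangle\mapsto|x,b\oplus F(x)\rangle$; let $M$ be the number of its solutions, i.e. of the $x$ with $F(x)=1$ ($M$ is not known to the algorithm). The cost of an algorithm is the number of its calls to $F$. Consider the following algorithms. * *Grover's algorithm with $j$ iterations*: start in the uniform superposition $|s\rangle$, apply $j$ times the phase flip of the solutions (one call) followed by the reflection $2|s\rangle\langle s|-1$, and measure. * *BBHT*: set $m=1$. While $m\le 2\sqrt N$: choose an integer $0\le j<m$ uniformly at random and run Grover's algorithm with $j$ iterations; if the outcome $x$ has $F(x)=1$, return $x$, otherwise replace $m$ by $1.31\,m$. If the loop ends, return *false*. * *BCWZ with parameter $\epsilon^{-1}$*: let $t_0=\min(N,\lceil\lg\epsilon^{-1}\rceil)$. For $t=1,\dots,t_0$ run the exact Grover search that finds a solution with certainty if there are exactly $t$ of them; it consists of $j_t=\left\lceil \pi/(4\theta_t)-1/2\right\rceil$ iterations, where $\sin^2\theta_t=t/N$, with the initial weight of the marked states lowered from $t/N$ to $\sin^2(\pi/(4j_t+2))$ by means of the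 target qubit. Then do $t_0$ searches, each made of up to three rounds of Grover's algorithm with a random integer number $0\le j<\sqrt{N/t_0}$ of iterations. Check every outcome with a call to $F$; return the first solution found, and *false* if there is none. * *findsol with parameter $\epsilon^{-1}$*: run BBHT up to twice, and then BCWZ with parameter $\epsilon^{-1}$; return the first solution found, and *false* if there is none. For every $\epsilon_0\in(0,1)$ there is a constant $C$ such that for every finite non-empty domain, every $F$ and every $0<\epsilon\le\epsilon_0$ the following holds for findsol with parameter $\epsilon^{-1}$. 1. It never returns an element that is not a solution. 2. If $M>0$, then the expected number of calls is at most $C\left(\sqrt{N/M}+\sqrt{N\lg\epsilon^{-1}}\,M^{-1.86}\right)$; the probability that it returns *false* is less than $0.5\,M^{-1.86}\,\epsilon$; and all solutions are returned with the same probability, so that a returned solution is a uniformly random one. 3. If $M=0$, then it returns *false* with probability $1$, and the expected number of calls is at most $C\sqrt{N\lg\epsilon^{-1}}$. 4. Whenever it returns *false*, it has made at most $C\sqrt{N\lg\epsilon^{-1}}$ calls. -/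

import Mathlib

namespace QuantumSearch

universe u v

/-! ### Quantum oracle model

The register holds an element of the domain `α` and one target qubit. -/

/-- The state space `ℂ^α ⊗ ℂ²`. -/
abbrev Reg (α : Type u) [Fintype α] : Type u := EuclideanSpace ℂ (α × Bool)

/-- The permutation `(x, b) ↦ (x, b ⊕ F x)` of the computational basis. -/
def oraclePerm {α : Type u} (F : α → Bool) : Equiv.Perm (α × Bool) where
  toFun p := (p.1, xor p.2 (F p.1))
  invFun p := (p.1, xor p.2 (F p.1))
  left_inv p := by simp
  right_inv p := by simp

/-- One quantum call to `F`: the unitary `|x, b⟩ ↦ |x, b ⊕ F x⟩`. -/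
noncomputable def oracle {α : Type u} [Fintype α] (F : α → Bool) : Reg α ≃ₗᵢ[ℂ] Reg α :=
  LinearIsometryEquiv.piLpCongrLeft 2 ℂ ℂ (oraclePerm F)

/-- A quantum query circuit: a unit start vector, and a list of unitaries each of which is
preceded by one oracle call.  Nothing in it may depend on `F`. -/
structure Circuit (α : Type u) [Fintype α] where
  init : Reg α
  norm_init : ‖init‖ = 1
  gates : List (Reg α ≃ₗᵢ[ℂ] Reg α)

/-- The number of oracle calls that a circuit makes. -/
def Circuit.calls {α : Type u} [Fintype α] (c : Circuit α) : ℕ := c.gates.length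

/-- The state before the measurement, when the circuit is run with oracle `F`. -/
noncomputable def Circuit.final {α : Type u} [Fintype α] (c : Circuit α) (F : α → Bool) : Reg α :=
  c.gates.foldl (fun ψ U => U (oracle F ψ)) c.init

theorem Circuit.norm_final {α : Type u} [Fintype α] (c : Circuit α) (F : α → Bool) :
    ‖c.final F‖ = 1 := by
  have key : ∀ (l : List (Reg α ≃ₗᵢ[ℂ] Reg α)) (ψ : Reg α),
      ‖l.foldl (fun ψ U => U (oracle F ψ)) ψ‖ = ‖ψ‖ := by
    intro l
    induction l with
    | nil => intro ψ; rfl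
    | cons U l ih => intro ψ; simp [ih]
  rw [Circuit.final, key, c.norm_init]

theorem Circuit.sum_final {α : Type u} [Fintype α] (c : Circuit α) (F : α → Bool) :
    ∑ x, ENNReal.ofReal (∑ b, ‖c.final F (x, b)‖ ^ 2) = 1 := by
  rw [← ENNReal.ofReal_sum_of_nonneg (fun x _ => Finset.sum_nonneg fun b _ => sq_nonneg _),
    ← Fintype.sum_prod_type', ← EuclideanSpace.norm_sq_eq, c.norm_final]
  simp

/-- The Born rule: the law of the outcome when the first register of the final state is measured
in the computational basis. -/
noncomputable def Circuit.outcome {α : Type u} [Fintype α] (c : Circuit α) (F : α → Bool) : PMF α :=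
  PMF.ofFintype (fun x => ENNReal.ofReal (∑ b, ‖c.final F (x, b)‖ ^ 2)) (c.sum_final F)

/-- Adaptive algorithms with oracle access to an unknown function on `α`, with result in `β`. -/
inductive Prog (α : Type u) [Fintype α] (β : Type v) : Type (max u v)
  /-- stop with a result -/
  | ret (r : β) : Prog α β
  /-- evaluate the unknown function at `x` (one call) -/
  | query (x : α) (k : Bool → Prog α β) : Prog α β
  /-- choose one of `0, …, n` uniformly at random -/
  | uniform (n : ℕ) (k : Fin (n + 1) → Prog α β) : Prog α β
  /-- run a circuit and measure -/
  | quantum (c : Circuit α) (k : α → Prog α β) : Prog α β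

/-- Sequential composition. -/
def Prog.bind {α : Type u} [Fintype α] {β γ : Type v} :
    Prog α β → (β → Prog α γ) → Prog α γ
  | .ret r, g => g r
  | .query x k, g => .query x fun b => (k b).bind g
  | .uniform n k, g => .uniform n fun i => (k i).bind g
  | .quantum c k, g => .quantum c fun x => (k x).bind g

/-- The joint law of the result and of the number of calls to `F`. -/
noncomputable def Prog.eval {α : Type u} [Fintype α] {β : Type v} (F : α → Bool) :
    Prog α β → PMF (β × ℕ)
  | .ret r => PMF.pure (r, 0)
  | .query x k => ((k (F x)).eval F).map fun r => (r.1, r.2 + 1)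
  | .uniform n k => (PMF.uniformOfFintype (Fin (n + 1))).bind fun i => (k i).eval F
  | .quantum c k => (c.outcome F).bind fun x =>
      ((k x).eval F).map fun r => (r.1, r.2 + c.calls)

/-- The expected number of calls. -/
noncomputable def expectedCalls {β : Type v} (P : PMF (β × ℕ)) : ENNReal :=
  ∑' r, P r * (r.2 : ENNReal)

/-- Run the programs of a list in order until one returns a result `some x`; return that result,
or `none` (the special value *false*) if there is none. -/
def firstSuccess {α : Type u} [Fintype α] :
    List (Prog α (Option α)) → Prog α (Option α)
  | [] => .ret none
  | p :: l => p.bind fun r =>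
      match r with
      | some x => .ret (some x)
      | none => firstSuccess l

/-! ### Grover iterations -/

/-- The state `|s⟩ ⊗ (cos β |+⟩ + sin β |-⟩)`, where `|s⟩` is the uniform superposition. -/
noncomputable def startState (α : Type u) [Fintype α] (β : ℝ) : Reg α :=
  WithLp.toLp 2 fun p =>
    (((Real.cos β + (if p.2 then -1 else 1) * Real.sin β) / √(2 * Fintype.card α) : ℝ) : ℂ)

theorem norm_startState (α : Type u) [Fintype α] [Nonempty α] (β : ℝ) :
    ‖startState α β‖ = 1 := by
  have hN : (0 : ℝ) < Fintype.card α := by exact_mod_cast Fintype.card_pos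
  have h : ‖startState α β‖ ^ 2 = 1 := by
    rw [EuclideanSpace.norm_sq_eq, Fintype.sum_prod_type]
    have key : ∀ x : α, ∑ b : Bool, ‖startState α β (x, b)‖ ^ 2 = 1 / Fintype.card α := by
      intro x
      simp only [startState, Complex.norm_real, Real.norm_eq_abs, sq_abs, div_pow,
        Fintype.sum_bool]
      rw [Real.sq_sqrt (by positivity)]
      simp only [if_true, Bool.false_eq_true, if_false]
      field_simp
      nlinarith [Real.sin_sq_add_cos_sq β]
    rw [Finset.sum_congr rfl fun x _ => key x, Finset.sum_const, Finset.card_univ, nsmul_eq_mul]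
    field_simp
  nlinarith [norm_nonneg (startState α β)]

/-- Amplitude amplification: from `startState α β`, do `j` times an oracle call followed by the
reflection `2|ψ⟩⟨ψ| - 1` about the start state `ψ`.  As the oracle fixes `|x⟩|+⟩` and maps
`|x⟩|-⟩` to `(-1)^(F x) |x⟩|-⟩`, the states marked by it are the `|x⟩|-⟩` with `F x = 1`. -/
noncomputable def amplify (α : Type u) [Fintype α] [Nonempty α] (β : ℝ) (j : ℕ) : Circuit α where
  init := startState α β
  norm_init := norm_startState α β
  gates := List.replicate j ((ℂ ∙ startState α β).reflection)

/-- Grover's algorithm with `j` Grover iterations: the target qubit is in the state `|-⟩`. -/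
noncomputable def grover (α : Type u) [Fintype α] [Nonempty α] (j : ℕ) : Circuit α :=
  amplify α (Real.pi / 2) j

/-- Number of iterations of the exact search when the number of solutions is `t`. -/
noncomputable def exactIter (N t : ℕ) : ℕ :=
  ⌈Real.pi / (4 * Real.arcsin √((t : ℝ) / N)) - 1 / 2⌉₊

/-- The exact version of Grover's algorithm for `t` solutions: the initial weight of the marked
states is lowered from `t / N` to `sin² (π / (4 j + 2))`, so that `j` iterations reach them with
certainty if there are exactly `t` solutions. -/
noncomputable def exactGrover (α : Type u) [Fintype α] [Nonempty α] (t : ℕ) : Circuit α :=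
  amplify α
    (Real.arcsin (Real.sin (Real.pi / (4 * exactIter (Fintype.card α) t + 2)) /
      √((t : ℝ) / Fintype.card α)))
    (exactIter (Fintype.card α) t)

/-- Run a circuit, let `x` be the outcome, and return `x` if `F x = 1` and *false* otherwise. -/
def runAndCheck {α : Type u} [Fintype α] (c : Circuit α) : Prog α (Option α) :=
  .quantum c fun x => .query x fun b => .ret (if b then some x else none)

/-- Choose an integer `0 ≤ j < m` uniformly at random (`m ≥ 1` real, so there are `⌈m⌉` such
integers), run Grover's algorithm with `j` iterations and check the outcome. -/
noncomputable def groverRound (α : Type u) [Fintype α] [Nonempty α] (m : ℝ) :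
    Prog α (Option α) :=
  .uniform (⌈m⌉₊ - 1) fun j => runAndCheck (grover α j)

/-! ### BBHT -/

/-- The growth factor. -/
noncomputable def growth : ℝ := 1.31

/-- The number of values `m = 1, growth, growth², …` with `m ≤ 2 √N`. -/
noncomputable def bbhtRounds (N : ℕ) : ℕ := ⌊Real.logb growth (2 * √N)⌋₊ + 1

theorem lt_bbhtRounds_iff {N : ℕ} (hN : 0 < N) (k : ℕ) :
    k < bbhtRounds N ↔ growth ^ k ≤ 2 * √N := by
  have hg : (1 : ℝ) < growth := by norm_num [growth]
  have h1 : (1 : ℝ) ≤ √N := by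
    rw [Real.one_le_sqrt]
    exact_mod_cast hN
  have hlog : 0 ≤ Real.logb growth (2 * √N) := Real.logb_nonneg hg (by linarith)
  rw [bbhtRounds, Nat.lt_succ_iff, Nat.le_floor_iff hlog, Real.le_logb_iff_rpow_le hg (by linarith),
    Real.rpow_natCast]

/-- The *BBHT* search: for `m = 1, growth, growth², …`, as long as `m ≤ 2 √N` and no solution has
been found, do a round of Grover's algorithm with a random number `j < m` of iterations. -/
noncomputable def bbht (α : Type u) [Fintype α] [Nonempty α] : Prog α (Option α) :=
  firstSuccess ((List.range (bbhtRounds (Fintype.card α))).map fun k =>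
    groverRound α (growth ^ k))

/-! ### BCWZ -/

/-- `t₀ = ⌈lg ε⁻¹⌉`, but at most the size of the domain. -/
noncomputable def bcwzCutoff (N : ℕ) (ε : ℝ) : ℕ := min N ⌈Real.logb 2 ε⁻¹⌉₊

/-- The *BCWZ* search with parameter `ε⁻¹`: exact searches for `t = 1, …, t₀` solutions; if they
all fail, `t₀` searches, each of them with `O(√(N / t₀))` calls and with probability of failure at
most `1/2` whenever there are at least `t₀` solutions.  Such a search is made of three rounds with
a random number `j < √(N / t₀)` of Grover iterations. -/
noncomputable def bcwz (α : Type u) [Fintype α] [Nonempty α] (ε : ℝ) : Prog α (Option α) :=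
  firstSuccess
    ((List.range (bcwzCutoff (Fintype.card α) ε)).map
        (fun i => runAndCheck (exactGrover α (i + 1))) ++
      List.replicate (bcwzCutoff (Fintype.card α) ε)
        (firstSuccess (List.replicate 3
          (groverRound α √((Fintype.card α : ℝ) / bcwzCutoff (Fintype.card α) ε)))))

/-! ### findsol -/

/-- *findsol*: run *BBHT* up to twice, then *BCWZ* with parameter `ε⁻¹`, and stop as soon as one of
them returns a solution. -/
noncomputable def findsol (α : Type u) [Fintype α] [Nonempty α] (ε : ℝ) : Prog α (Option α) :=
  firstSuccess [bbht α, bbht α, bcwz α ε]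

/-- The number `M` of solutions of `F`. -/
def numSolutions {α : Type u} [Fintype α] (F : α → Bool) : ℕ :=
  (Finset.univ.filter fun x => F x = true).card

/-- The joint law of the result of *findsol* on `F` and of its number of calls to `F`. -/
noncomputable def findsolLaw {α : Type u} [Fintype α] [Nonempty α] (F : α → Bool) (ε : ℝ) :
    PMF (Option α × ℕ) :=
  (findsol α ε).eval F

/-- The probability that the result is `r`. -/
noncomputable def probResult {β : Type v} (P : PMF (β × ℕ)) (r : β) : ENNReal :=
  (P.map Prod.fst) r

end QuantumSearch

/-! In a sequential search the failure probabilities multiply (`failProb_cons`), and each later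
stage contributes its expected calls weighted by the probability of reaching it
(`expectedCalls_cons`). It therefore suffices to know three facts about each stage: its failure
probability, its cost, and its symmetry among solutions.

Quantum part. The oracle and the reflection preserve the span of the marked and unmarked parts of
the start state, so a run is described by two real coefficients (`final_amplify`). If the marked
weight is `sin² γ`, then `j` iterations bring the angle to `(2j+1)γ` (`iterCoeff_sin_sq`). The state
depends on `x` only through `F x`, which gives uniformity among solutions; checking each outcome
gives soundness. In the exact search `(2j+1)γ = π/2`, so it cannot fail.

BBHT. Averaging `cos² ((2j+1)θ)` over `j < k` gives `1/2 + sin(4kθ) / (4k sin 2θ)` (`meanFail_eq`).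
Once `m` exceeds a multiple of `1 / sin θ = √(N/M)`, a round fails with probability at most `3/5`
when `cos θ ≥ 1/2`. About `log √M` rounds, to base `growth`, remain up to `2√N`. As `growth ^ 1.86 ≤
5/3`, one BBHT run fails with probability at most `0.7 · (√M)^(-1.86)` for `M ≥ 2`; angles near
`π/2` need a separate argument. Two runs give `0.49 · M^(-1.86)`, below the required `0.5`. A
potential function bounds the expected cost of one run by `O(√(N/M))`.

BCWZ. If `M ≤ t₀`, one of the exact searches is the right one and failure is impossible. Otherwise
`M > t₀ ≥ 1`, hence `M ≥ 2`, and the `t₀` randomized searches fail with probability at most `2^(-t₀)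
≤ ε`. The worst-case cost is `O(√(N t₀))`, and it is incurred with probability at most `M^(-1.86)`.
Finally `ε ≤ ε₀ < 1` keeps `lg ε⁻¹` away from `0`, so that `t₀ = O(lg ε⁻¹)` despite the ceiling. -/

namespace QuantumSearch
open scoped ENNReal

universe u v

/-! ### Expectations over discrete laws -/

/-- The expectation of an `ℝ≥0∞`-valued function. -/
noncomputable def expect {γ : Type v} (P : PMF γ) (f : γ → ℝ≥0∞) : ℝ≥0∞ := ∑' a, P a * f a

theorem expect_pure {γ : Type v} (a : γ) (f : γ → ℝ≥0∞) : expect (PMF.pure a) f = f a := by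
  classical
  rw [expect, tsum_eq_single a]
  · simp
  · intro b hb
    simp [PMF.pure_apply, hb]

theorem expect_bind {γ : Type u} {δ : Type v} (P : PMF γ) (g : γ → PMF δ) (f : δ → ℝ≥0∞) :
    expect (P.bind g) f = expect P fun a => expect (g a) f := by
  simp only [expect, PMF.bind_apply, ← ENNReal.tsum_mul_right, ← ENNReal.tsum_mul_left]
  rw [ENNReal.tsum_comm]
  simp only [mul_assoc]

theorem expect_map {γ : Type u} {δ : Type v} (P : PMF γ) (g : γ → δ) (f : δ → ℝ≥0∞) :
    expect (P.map g) f = expect P fun a => f (g a) := by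
  simp only [PMF.map, expect_bind, Function.comp_apply, expect_pure]

theorem expect_add {γ : Type v} (P : PMF γ) (f g : γ → ℝ≥0∞) :
    (expect P fun a => f a + g a) = expect P f + expect P g := by
  simp only [expect, mul_add, ENNReal.tsum_add]

theorem expect_mul_const {γ : Type v} (P : PMF γ) (f : γ → ℝ≥0∞) (c : ℝ≥0∞) :
    (expect P fun a => f a * c) = expect P f * c := by
  simp only [expect, ← ENNReal.tsum_mul_right, mul_assoc]

theorem expect_const {γ : Type v} (P : PMF γ) (c : ℝ≥0∞) : (expect P fun _ => c) = c := by
  rw [expect, ENNReal.tsum_mul_right, P.tsum_coe, one_mul]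

theorem expect_le_of_support {γ : Type v} (P : PMF γ) (f : γ → ℝ≥0∞) (c : ℝ≥0∞)
    (h : ∀ a ∈ P.support, f a ≤ c) : expect P f ≤ c := by
  rw [← expect_const P c]
  refine ENNReal.tsum_le_tsum fun a => ?_
  by_cases ha : P a = 0
  · simp [ha]
  · gcongr
    exact h a ((PMF.mem_support_iff _ _).2 ha)

open Classical in
theorem probResult_eq_expect {β : Type v} (P : PMF (β × ℕ)) (r : β) :
    probResult P r = expect P fun s => if s.1 = r then 1 else 0 := by
  rw [probResult, PMF.map_apply, expect]
  refine tsum_congr fun s => ?_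
  by_cases h : s.1 = r
  · simp [h]
  · simp [h, Ne.symm h]

theorem expectedCalls_eq_expect {β : Type v} (P : PMF (β × ℕ)) :
    expectedCalls P = expect P fun s => (s.2 : ℝ≥0∞) := rfl

theorem probResult_le_one {β : Type v} (P : PMF (β × ℕ)) (r : β) : probResult P r ≤ 1 :=
  PMF.coe_le_one _ _

/-! ### Laws of composite programs -/

section Composition

variable {α : Type u} [Fintype α] (F : α → Bool)

theorem Prog.eval_bind {β γ : Type v} (p : Prog α β) (g : β → Prog α γ) :
    (p.bind g).eval F =
      (p.eval F).bind fun r => ((g r.1).eval F).map fun s => (s.1, s.2 + r.2) := by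
  induction p with
  | ret r => simp [Prog.bind, Prog.eval, PMF.pure_bind, ← Function.id_def, PMF.map_id]
  | query x k ih =>
    simp only [Prog.bind, Prog.eval, ih, PMF.map_bind, PMF.bind_map, PMF.map_comp]
    rfl
  | uniform n k ih =>
    simp only [Prog.bind, Prog.eval, ih, PMF.bind_bind]
  | quantum c k ih =>
    simp only [Prog.bind, Prog.eval, ih, PMF.map_bind, PMF.bind_map, PMF.map_comp, PMF.bind_bind]
    congr 1
    funext x
    congr 1
    funext r
    simp only [Function.comp_def, add_assoc]

/-- The common source of the composition rules: indicators as `f` give the result probabilities, and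
the call counter as `f` gives the expected cost. -/
theorem expect_firstSuccess_cons (p : Prog α (Option α)) (l : List (Prog α (Option α)))
    (f : Option α × ℕ → ℝ≥0∞) :
    expect ((firstSuccess (p :: l)).eval F) f =
      expect (p.eval F) fun r => match r.1 with
        | some x => f (some x, r.2)
        | none => expect ((firstSuccess l).eval F) fun s => f (s.1, s.2 + r.2) := by
  rw [firstSuccess, Prog.eval_bind, expect_bind]
  congr 1
  funext r
  rw [expect_map]
  rcases r with ⟨_ | x, n⟩
  · rfl
  · simp [Prog.eval, expect_pure]

/-- The probability that a search fails. -/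
noncomputable def failProb (p : Prog α (Option α)) : ℝ≥0∞ := probResult (p.eval F) none

theorem failProb_le_one (p : Prog α (Option α)) : failProb F p ≤ 1 := probResult_le_one _ _

theorem failProb_nil : failProb F (firstSuccess []) = 1 := by
  rw [failProb, probResult_eq_expect, firstSuccess, Prog.eval, expect_pure, if_pos rfl]

/-- After a failure the remaining list is run afresh, independently of what was measured before. -/
theorem failProb_cons (p : Prog α (Option α)) (l : List (Prog α (Option α))) :
    failProb F (firstSuccess (p :: l)) = failProb F p * failProb F (firstSuccess l) := by
  classical
  simp only [failProb, probResult_eq_expect]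
  rw [expect_firstSuccess_cons, ← expect_mul_const]
  congr 1
  funext r
  rcases r with ⟨_ | x, n⟩ <;> simp

theorem failProb_firstSuccess (l : List (Prog α (Option α))) :
    failProb F (firstSuccess l) = (l.map (failProb F)).prod := by
  induction l with
  | nil => simp [failProb_nil]
  | cons p l ih => rw [failProb_cons, ih, List.map_cons, List.prod_cons]

theorem probResult_some_cons (p : Prog α (Option α)) (l : List (Prog α (Option α))) (x : α) :
    probResult ((firstSuccess (p :: l)).eval F) (some x) =
      probResult (p.eval F) (some x) +
        failProb F p * probResult ((firstSuccess l).eval F) (some x) := by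
  classical
  simp only [failProb, probResult_eq_expect]
  rw [expect_firstSuccess_cons, ← expect_mul_const, ← expect_add]
  congr 1
  funext r
  rcases r with ⟨_ | y, n⟩ <;> simp

theorem expectedCalls_nil : expectedCalls ((firstSuccess (α := α) []).eval F) = 0 := by
  simp [expectedCalls_eq_expect, firstSuccess, Prog.eval, expect_pure]

theorem expectedCalls_cons (p : Prog α (Option α)) (l : List (Prog α (Option α))) :
    expectedCalls ((firstSuccess (p :: l)).eval F) =
      expectedCalls (p.eval F) + failProb F p * expectedCalls ((firstSuccess l).eval F) := by
  classical
  simp only [failProb, probResult_eq_expect, expectedCalls_eq_expect]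
  rw [expect_firstSuccess_cons, ← expect_mul_const, ← expect_add]
  congr 1
  funext r
  rcases r with ⟨_ | y, n⟩
  · simp only [if_true, one_mul, Nat.cast_add, expect_add, expect_const]
    exact add_comm _ _
  · simp

/-- Every run of `p` makes at most `b` calls. -/
def CallsLE (p : Prog α (Option α)) (b : ℝ) : Prop := ∀ r ∈ (p.eval F).support, (r.2 : ℝ) ≤ b

/-- Only solutions are returned by `p`. -/
def Sound (p : Prog α (Option α)) : Prop :=
  ∀ r ∈ (p.eval F).support, ∀ x, r.1 = some x → F x = true

/-- All solutions are returned by `p` with the same probability. -/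
def Fair (p : Prog α (Option α)) : Prop :=
  ∀ x y, F x = true → F y = true →
    probResult (p.eval F) (some x) = probResult (p.eval F) (some y)

variable {F}

/-! ### Worst-case cost, soundness and fairness under sequential composition -/

theorem CallsLE.mono {p : Prog α (Option α)} {a b : ℝ} (h : CallsLE F p a) (hab : a ≤ b) :
    CallsLE F p b := fun r hr => (h r hr).trans hab

theorem CallsLE.expectedCalls_le {p : Prog α (Option α)} {b : ℝ} (h : CallsLE F p b) :
    expectedCalls (p.eval F) ≤ ENNReal.ofReal b := by
  refine expect_le_of_support _ _ _ fun r hr => ?_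
  rw [← ENNReal.ofReal_natCast]
  exact ENNReal.ofReal_le_ofReal (h r hr)

theorem mem_support_firstSuccess_cons {p : Prog α (Option α)} {l : List (Prog α (Option α))}
    {r : Option α × ℕ} (hr : r ∈ ((firstSuccess (p :: l)).eval F).support) :
    r ∈ (p.eval F).support ∨ ∃ a ∈ (p.eval F).support, ∃ b ∈ ((firstSuccess l).eval F).support,
      r = (b.1, b.2 + a.2) := by
  rw [firstSuccess, Prog.eval_bind, PMF.mem_support_bind_iff] at hr
  obtain ⟨a, ha, hr⟩ := hr
  rw [PMF.mem_support_map_iff] at hr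
  obtain ⟨b, hb, rfl⟩ := hr
  rcases a with ⟨_ | x, n⟩
  · exact Or.inr ⟨_, ha, b, hb, rfl⟩
  · simp only [Prog.eval, PMF.support_pure, Set.mem_singleton_iff] at hb
    subst hb
    left
    simpa using ha

theorem CallsLE.nil : CallsLE F (firstSuccess []) 0 := by
  intro r hr
  simp only [firstSuccess, Prog.eval, PMF.support_pure, Set.mem_singleton_iff] at hr
  simp [hr]

theorem CallsLE.cons {p : Prog α (Option α)} {l : List (Prog α (Option α))} {a b : ℝ}
    (hp : CallsLE F p a) (hl : CallsLE F (firstSuccess l) b) (hb : 0 ≤ b) :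
    CallsLE F (firstSuccess (p :: l)) (a + b) := by
  intro r hr
  rcases mem_support_firstSuccess_cons hr with h | ⟨s, hs, t, ht, rfl⟩
  · linarith [hp r h]
  · push_cast
    linarith [hp s hs, hl t ht]

theorem CallsLE.map_append {ι : Type*} {l : List ι} {f : ι → Prog α (Option α)} {c : ι → ℝ}
    {l₂ : List (Prog α (Option α))} {b : ℝ} (h₁ : ∀ i ∈ l, CallsLE F (f i) (c i) ∧ 0 ≤ c i)
    (h₂ : CallsLE F (firstSuccess l₂) b) (hb : 0 ≤ b) :
    CallsLE F (firstSuccess (l.map f ++ l₂)) ((l.map c).sum + b) := by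
  induction l with
  | nil => simpa using h₂
  | cons i l ih =>
    have hl := ih fun q hq => h₁ q (List.mem_cons_of_mem _ hq)
    have h0 : 0 ≤ (l.map c).sum := List.sum_nonneg fun y hy => by
      obtain ⟨q, hq, rfl⟩ := List.mem_map.1 hy
      exact (h₁ q (List.mem_cons_of_mem _ hq)).2
    rw [List.map_cons, List.map_cons, List.sum_cons, add_assoc]
    exact (h₁ i List.mem_cons_self).1.cons hl (by linarith)

theorem CallsLE.replicate {p : Prog α (Option α)} {b : ℝ} (h : CallsLE F p b) (hb : 0 ≤ b)
    (n : ℕ) : CallsLE F (firstSuccess (List.replicate n p)) (n * b) := by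
  induction n with
  | zero => simpa using CallsLE.nil
  | succ n ih =>
    rw [List.replicate_succ]
    exact (h.cons ih (by positivity)).mono (by push_cast; linarith)

theorem Sound.firstSuccess {l : List (Prog α (Option α))} (h : ∀ p ∈ l, Sound F p) :
    Sound F (firstSuccess l) := by
  induction l with
  | nil =>
    intro r hr x hx
    simp only [QuantumSearch.firstSuccess, Prog.eval, PMF.support_pure,
      Set.mem_singleton_iff] at hr
    simp [hr] at hx
  | cons p l ih =>
    intro r hr x hx
    rcases mem_support_firstSuccess_cons hr with h' | ⟨s, hs, t, ht, rfl⟩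
    · exact h p List.mem_cons_self r h' x hx
    · exact ih (fun q hq => h q (List.mem_cons_of_mem _ hq)) t ht x hx

theorem Sound.failProb_eq_one {p : Prog α (Option α)} (h : Sound F p) (hF : ∀ x, F x = false) :
    failProb F p = 1 := by
  rw [failProb, probResult, PMF.apply_eq_one_iff]
  refine (PMF.support_nonempty _).subset_singleton_iff.1 fun r hr => ?_
  rw [PMF.mem_support_map_iff] at hr
  obtain ⟨s, hs, rfl⟩ := hr
  rcases hx : s.1 with _ | x
  · rfl
  · simpa [hF x] using h s hs x hx

theorem Fair.firstSuccess {l : List (Prog α (Option α))} (h : ∀ p ∈ l, Fair F p) :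
    Fair F (firstSuccess l) := by
  classical
  induction l with
  | nil =>
    intro x y _ _
    simp [probResult_eq_expect, QuantumSearch.firstSuccess, Prog.eval, expect_pure]
  | cons p l ih =>
    intro x y hx hy
    rw [probResult_some_cons, probResult_some_cons, h p List.mem_cons_self x y hx hy,
      ih (fun q hq => h q (List.mem_cons_of_mem _ hq)) x y hx hy]

/-! ### Checked measurements and randomized rounds -/

theorem failProb_runAndCheck (c : Circuit α) :
    failProb F (runAndCheck c) = ∑ x with F x = false, c.outcome F x := by
  classical
  rw [failProb, probResult_eq_expect, runAndCheck]
  simp only [Prog.eval, expect_bind, expect_map, expect_pure]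
  rw [expect, tsum_fintype, Finset.sum_filter]
  refine Finset.sum_congr rfl fun x _ => ?_
  cases F x <;> simp

theorem probResult_runAndCheck_some (c : Circuit α) {x : α} (hx : F x = true) :
    probResult ((runAndCheck c).eval F) (some x) = c.outcome F x := by
  classical
  rw [probResult_eq_expect, runAndCheck]
  simp only [Prog.eval, expect_bind, expect_map, expect_pure]
  rw [expect, tsum_fintype, Finset.sum_eq_single x]
  · simp [hx]
  · intro y _ hy
    cases F y <;> simp [hy]
  · simp

theorem CallsLE.runAndCheck (c : Circuit α) : CallsLE F (runAndCheck c) (c.calls + 1) := by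
  intro r hr
  simp only [QuantumSearch.runAndCheck, Prog.eval, PMF.mem_support_bind_iff,
    PMF.mem_support_map_iff, PMF.support_pure, Set.mem_singleton_iff] at hr
  obtain ⟨x, -, s, ⟨t, rfl, rfl⟩, rfl⟩ := hr
  simp [add_comm]

theorem Sound.runAndCheck (c : Circuit α) : Sound F (runAndCheck c) := by
  intro r hr x hx
  simp only [QuantumSearch.runAndCheck, Prog.eval, PMF.mem_support_bind_iff,
    PMF.mem_support_map_iff, PMF.support_pure, Set.mem_singleton_iff] at hr
  obtain ⟨y, -, s, ⟨t, rfl, rfl⟩, rfl⟩ := hr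
  cases hy : F y
  · simp [hy] at hx
  · simp [hy] at hx
    rwa [← hx]

theorem expect_uniform (n : ℕ) (f : Fin (n + 1) → ℝ≥0∞) :
    expect (PMF.uniformOfFintype (Fin (n + 1))) f = ((n + 1 : ℕ) : ℝ≥0∞)⁻¹ * ∑ i, f i := by
  simp [expect, tsum_fintype, Finset.mul_sum]

theorem probResult_uniform (n : ℕ) (k : Fin (n + 1) → Prog α (Option α)) (r : Option α) :
    probResult ((Prog.uniform n k).eval F) r =
      ((n + 1 : ℕ) : ℝ≥0∞)⁻¹ * ∑ i, probResult ((k i).eval F) r := by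
  classical
  simp only [probResult_eq_expect, Prog.eval, expect_bind, expect_uniform]

theorem CallsLE.uniform {n : ℕ} {k : Fin (n + 1) → Prog α (Option α)} {b : ℝ}
    (h : ∀ i, CallsLE F (k i) b) : CallsLE F (.uniform n k) b := by
  intro r hr
  simp only [Prog.eval, PMF.mem_support_bind_iff] at hr
  obtain ⟨i, -, hr⟩ := hr
  exact h i r hr

theorem Sound.uniform {n : ℕ} {k : Fin (n + 1) → Prog α (Option α)}
    (h : ∀ i, Sound F (k i)) : Sound F (.uniform n k) := by
  intro r hr
  simp only [Prog.eval, PMF.mem_support_bind_iff] at hr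
  obtain ⟨i, -, hr⟩ := hr
  exact h i r hr

theorem Fair.uniform {n : ℕ} {k : Fin (n + 1) → Prog α (Option α)}
    (h : ∀ i, Fair F (k i)) : Fair F (.uniform n k) := by
  intro x y hx hy
  simp only [probResult_uniform]
  simp only [h _ x y hx hy]

end Composition

/-! ### Amplitudes -/

/-- The coefficients of the marked and of the unmarked part of the start state after `j`
iterations, when the marked part has weight `w`. -/
noncomputable def iterCoeff (w : ℝ) : ℕ → ℝ × ℝ
  | 0 => (1, 1)
  | j + 1 =>
    let c := iterCoeff w j
    let s := 2 * (c.2 * (1 - w) - c.1 * w)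
    (s + c.1, s - c.2)

/-- One iteration is a rotation by `2γ` in the plane of the normalized marked and unmarked parts,
whose initial coordinates are `sin γ` and `cos γ`. The products avoid dividing by a sine or cosine
that may vanish. -/
theorem iterCoeff_sin_sq (γ : ℝ) (j : ℕ) :
    (iterCoeff (Real.sin γ ^ 2) j).1 * Real.sin γ = Real.sin ((2 * j + 1) * γ) ∧
      (iterCoeff (Real.sin γ ^ 2) j).2 * Real.cos γ = Real.cos ((2 * j + 1) * γ) := by
  induction j with
  | zero => simp [iterCoeff]
  | succ j ih =>
    have h : (2 * ((j + 1 : ℕ) : ℝ) + 1) * γ = (2 * j + 1) * γ + 2 * γ := by push_cast; ring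
    have hc := Real.sin_sq_add_cos_sq γ
    rw [h, Real.sin_add, Real.cos_add, ← ih.1, ← ih.2, Real.sin_two_mul, Real.cos_two_mul]
    simp only [iterCoeff]
    constructor
    · linear_combination (-2 * (iterCoeff (Real.sin γ ^ 2) j).2 * Real.sin γ -
        2 * (iterCoeff (Real.sin γ ^ 2) j).1 * Real.sin γ) * hc
    · linear_combination (-2 * (iterCoeff (Real.sin γ ^ 2) j).2 * Real.cos γ) * hc

section States

variable {α : Type u} [Fintype α]

/-- The combination of the marked and of the unmarked part of `startState α β` with
coefficients `c.1` and `c.2`. -/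
noncomputable def combState (F : α → Bool) (β : ℝ) (c : ℝ × ℝ) : Reg α :=
  WithLp.toLp 2 fun p =>
    (((Real.cos β * c.2 + (if p.2 then -1 else 1) * (Real.sin β * if F p.1 then c.1 else c.2)) /
      √(2 * Fintype.card α) : ℝ) : ℂ)

theorem combState_one (F : α → Bool) (β : ℝ) : combState F β (1, 1) = startState α β := by
  ext p
  simp [combState, startState]

theorem oracle_combState (F : α → Bool) (β : ℝ) (c : ℝ × ℝ) :
    oracle F (combState F β c) = combState F β (-c.1, c.2) := by
  ext p
  rw [oracle, LinearIsometryEquiv.piLpCongrLeft_apply]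
  obtain ⟨x, b⟩ := p
  simp only [combState, Equiv.piCongrLeft'_apply, oraclePerm, Equiv.coe_fn_symm_mk]
  rcases Bool.eq_false_or_eq_true (F x) with hx | hx <;> cases b <;> simp [hx]

theorem sum_ite_solution (F : α → Bool) (a b : ℝ) :
    (∑ x, if F x then a else b) =
      numSolutions F * a + (Fintype.card α - numSolutions F) * b := by
  have h := Finset.card_filter_add_card_filter_not (s := Finset.univ) (fun x => F x = true)
  rw [Finset.sum_ite, Finset.sum_const, Finset.sum_const, nsmul_eq_mul, nsmul_eq_mul,
    ← Finset.card_univ, ← h, numSolutions]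
  push_cast
  ring

theorem numSolutions_le_card (F : α → Bool) : numSolutions F ≤ Fintype.card α :=
  Finset.card_filter_le _ _

variable [Nonempty α]

/-- The weight of the marked part of `startState α β`. -/
noncomputable def markedWeight (F : α → Bool) (β : ℝ) : ℝ :=
  Real.sin β ^ 2 * (numSolutions F / Fintype.card α)

theorem inner_startState_combState (F : α → Bool) (β : ℝ) (c : ℝ × ℝ) :
    inner ℂ (startState α β) (combState F β c) =
      ((c.2 * (1 - markedWeight F β) + c.1 * markedWeight F β : ℝ) : ℂ) := by
  have hN : (0 : ℝ) < Fintype.card α := by exact_mod_cast Fintype.card_pos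
  have h2 : √(2 * (Fintype.card α : ℝ)) ^ 2 = 2 * Fintype.card α := Real.sq_sqrt (by positivity)
  have h0 : √(2 * (Fintype.card α : ℝ)) ≠ 0 := by positivity
  have hb := Real.sin_sq_add_cos_sq β
  have key : ∀ x : α, ∑ b : Bool, inner ℂ (startState α β (x, b)) (combState F β c (x, b)) =
      ((if F x then (Real.cos β ^ 2 * c.2 + Real.sin β ^ 2 * c.1) / Fintype.card α
        else (Real.cos β ^ 2 * c.2 + Real.sin β ^ 2 * c.2) / Fintype.card α : ℝ) : ℂ) := by
    intro x
    simp only [startState, combState, RCLike.inner_apply, Complex.conj_ofReal, Fintype.sum_bool]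
    rw [← Complex.ofReal_mul, ← Complex.ofReal_mul, ← Complex.ofReal_add]
    congr 1
    cases F x <;>
    · simp only [if_true, Bool.false_eq_true, if_false]
      field_simp
      rw [h2]
      ring
  rw [PiLp.inner_apply, Fintype.sum_prod_type, Finset.sum_congr rfl fun x _ => key x,
    ← Complex.ofReal_sum, sum_ite_solution, markedWeight]
  congr 1
  field_simp
  linear_combination (Fintype.card α * c.2) * hb

theorem reflection_combState (F : α → Bool) (β : ℝ) (c : ℝ × ℝ) :
    (ℂ ∙ startState α β).reflection (combState F β c) =
      combState F β
        (2 * (c.2 * (1 - markedWeight F β) + c.1 * markedWeight F β) - c.1,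
          2 * (c.2 * (1 - markedWeight F β) + c.1 * markedWeight F β) - c.2) := by
  rw [Submodule.reflection_apply, Submodule.starProjection_unit_singleton ℂ (norm_startState α β),
    inner_startState_combState]
  generalize c.2 * (1 - markedWeight F β) + c.1 * markedWeight F β = d
  ext ⟨x, b⟩
  simp only [startState, combState, PiLp.sub_apply, PiLp.smul_apply, smul_eq_mul, nsmul_eq_mul]
  push_cast
  cases F x <;> cases b <;> simp <;> ring

theorem final_amplify (F : α → Bool) (β : ℝ) (j : ℕ) :
    (amplify α β j).final F = combState F β (iterCoeff (markedWeight F β) j) := by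
  simp only [Circuit.final, amplify]
  induction j with
  | zero => simp [iterCoeff, combState_one]
  | succ j ih =>
    rw [List.replicate_succ', List.foldl_append, ih, List.foldl_cons, List.foldl_nil,
      oracle_combState, reflection_combState]
    congr 1
    simp only [iterCoeff]
    ext <;> ring

theorem outcome_amplify_of_true {F : α → Bool} (β : ℝ) (j : ℕ) {x y : α} (hx : F x = true)
    (hy : F y = true) :
    (amplify α β j).outcome F x = (amplify α β j).outcome F y := by
  simp only [Circuit.outcome, PMF.ofFintype_apply, final_amplify, combState, hx, hy]

/-- On a non-solution the two target amplitudes are proportional to `cos β ± sin β`. The cross terms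
cancel in the sum of squares, so `β` enters only through the marked weight. -/
theorem outcome_amplify_of_false {F : α → Bool} (β : ℝ) (j : ℕ) {x : α} (hx : F x = false) :
    (amplify α β j).outcome F x =
      ENNReal.ofReal ((iterCoeff (markedWeight F β) j).2 ^ 2 / Fintype.card α) := by
  have hN : (0 : ℝ) < Fintype.card α := by exact_mod_cast Fintype.card_pos
  simp only [Circuit.outcome, PMF.ofFintype_apply, final_amplify, combState, hx,
    Complex.norm_real, Real.norm_eq_abs, sq_abs, div_pow, Fintype.sum_bool]
  rw [Real.sq_sqrt (by positivity)]
  congr 1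
  simp only [if_true, Bool.false_eq_true, if_false]
  field_simp
  linear_combination (2 * (iterCoeff (markedWeight F β) j).2 ^ 2) * Real.sin_sq_add_cos_sq β

theorem failProb_amplify (F : α → Bool) (β : ℝ) (j : ℕ) :
    failProb F (runAndCheck (amplify α β j)) =
      ENNReal.ofReal ((1 - numSolutions F / Fintype.card α) *
        (iterCoeff (markedWeight F β) j).2 ^ 2) := by
  have hN : (0 : ℝ) < Fintype.card α := by exact_mod_cast Fintype.card_pos
  have h := sum_ite_solution F 0 ((iterCoeff (markedWeight F β) j).2 ^ 2 / Fintype.card α)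
  rw [failProb_runAndCheck, Finset.sum_congr rfl fun x hx =>
    outcome_amplify_of_false β j (Finset.mem_filter.1 hx).2,
    ← ENNReal.ofReal_sum_of_nonneg fun x _ => by positivity, Finset.sum_filter]
  congr 1
  trans ∑ x, if F x then 0 else (iterCoeff (markedWeight F β) j).2 ^ 2 / Fintype.card α
  · refine Finset.sum_congr rfl fun x _ => ?_
    cases F x <;> simp
  · rw [h]
    field_simp
    ring

/-- The angle between the start state of Grover's algorithm and the unmarked states. -/
noncomputable def groverAngle (F : α → Bool) : ℝ :=
  Real.arcsin √((numSolutions F : ℝ) / Fintype.card α)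

theorem solution_ratio_le_one (F : α → Bool) : (numSolutions F : ℝ) / Fintype.card α ≤ 1 :=
  div_le_one_of_le₀ (by exact_mod_cast numSolutions_le_card F) (by positivity)

theorem sin_groverAngle (F : α → Bool) :
    Real.sin (groverAngle F) = √((numSolutions F : ℝ) / Fintype.card α) := by
  rw [groverAngle, Real.sin_arcsin]
  · linarith [Real.sqrt_nonneg ((numSolutions F : ℝ) / Fintype.card α)]
  · exact Real.sqrt_le_one.2 (solution_ratio_le_one F)

theorem sin_groverAngle_sq (F : α → Bool) :
    Real.sin (groverAngle F) ^ 2 = numSolutions F / Fintype.card α := by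
  rw [sin_groverAngle, Real.sq_sqrt (by positivity)]

theorem failProb_grover (F : α → Bool) (j : ℕ) :
    failProb F (runAndCheck (grover α j)) =
      ENNReal.ofReal (Real.cos ((2 * j + 1) * groverAngle F) ^ 2) := by
  have hw : markedWeight F (Real.pi / 2) = Real.sin (groverAngle F) ^ 2 := by
    rw [markedWeight, sin_groverAngle_sq, Real.sin_pi_div_two, one_pow, one_mul]
  rw [grover, failProb_amplify, hw, ← (iterCoeff_sin_sq _ j).2, ← sin_groverAngle_sq]
  congr 1
  linear_combination (-(iterCoeff (Real.sin (groverAngle F) ^ 2) j).2 ^ 2) *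
    Real.sin_sq_add_cos_sq (groverAngle F)

theorem exactIter_spec {N t : ℕ} (ht : 0 < t) (hN : t ≤ N) :
    Real.pi / (4 * exactIter N t + 2) ≤ Real.arcsin √((t : ℝ) / N) := by
  have hN0 : (0 : ℝ) < N := by exact_mod_cast ht.trans_le hN
  have ht0 : (0 : ℝ) < t := by exact_mod_cast ht
  have h0 : 0 < Real.arcsin √((t : ℝ) / N) := Real.arcsin_pos.2 (by positivity)
  have h := Nat.le_ceil (Real.pi / (4 * Real.arcsin √((t : ℝ) / N)) - 1 / 2)
  rw [← exactIter, sub_le_iff_le_add, div_le_iff₀ (by positivity)] at h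
  rw [div_le_iff₀ (by positivity)]
  linarith

/-- The lowered weight is `sin² γ` with `γ = π / (4j+2)`, so `j` iterations turn the angle to
exactly `π/2`. The rounding up in `exactIter` ensures `sin γ ≤ √(M/N)`, so that the weight can
indeed be lowered to this value. -/
theorem failProb_exactGrover (F : α → Bool) (hM : 0 < numSolutions F) :
    failProb F (runAndCheck (exactGrover α (numSolutions F))) = 0 := by
  have hN : (0 : ℝ) < Fintype.card α := by exact_mod_cast Fintype.card_pos
  have hM0 : (0 : ℝ) < numSolutions F := by exact_mod_cast hM
  have hj := exactIter_spec hM (numSolutions_le_card F)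
  rw [exactGrover]
  set j := exactIter (Fintype.card α) (numSolutions F)
  set r : ℝ := (numSolutions F : ℝ) / Fintype.card α with hr
  have hr0 : 0 < r := by positivity
  set γ := Real.pi / (4 * (j : ℝ) + 2) with hγ
  have hγ0 : 0 ≤ γ := by positivity
  have hγ1 : γ ≤ Real.pi / 2 := hj.trans (Real.arcsin_le_pi_div_two _)
  have hs : Real.sin γ ≤ √r := by
    rw [← sin_groverAngle F]
    exact Real.sin_le_sin_of_le_of_le_pi_div_two (by linarith [Real.pi_pos])
      (Real.arcsin_le_pi_div_two _) hj
  have hs0 : 0 ≤ Real.sin γ := Real.sin_nonneg_of_nonneg_of_le_pi hγ0 (by linarith [Real.pi_pos])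
  have hw : markedWeight F (Real.arcsin (Real.sin γ / √r)) = Real.sin γ ^ 2 := by
    rw [markedWeight, Real.sin_arcsin, div_pow, Real.sq_sqrt hr0.le, ← hr, div_mul_cancel₀ _ hr0.ne']
    · linarith [show 0 ≤ Real.sin γ / √r by positivity]
    · exact div_le_one_of_le₀ hs (Real.sqrt_nonneg _)
  rw [failProb_amplify, hw, ← hr, ENNReal.ofReal_eq_zero]
  have hc : (iterCoeff (Real.sin γ ^ 2) j).2 * Real.cos γ = 0 := by
    rw [(iterCoeff_sin_sq γ j).2, show (2 * (j : ℝ) + 1) * γ = Real.pi / 2 by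
      rw [hγ]; field_simp; ring, Real.cos_pi_div_two]
  have hr1 : Real.sin γ ^ 2 ≤ r := by
    calc Real.sin γ ^ 2 ≤ √r ^ 2 := by gcongr
      _ = r := Real.sq_sqrt hr0.le
  -- Only the product of the coefficient with `cos γ` is known to vanish. Since `sin² γ ≤ r`,
  -- replacing `1 - r` by `cos² γ` is enough, and it also covers `γ = π/2`.
  calc (1 - r) * (iterCoeff (Real.sin γ ^ 2) j).2 ^ 2
      ≤ (1 - Real.sin γ ^ 2) * (iterCoeff (Real.sin γ ^ 2) j).2 ^ 2 := by gcongr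
    _ = ((iterCoeff (Real.sin γ ^ 2) j).2 * Real.cos γ) ^ 2 := by
        rw [← Real.cos_sq']; ring
    _ ≤ 0 := by rw [hc]; norm_num

theorem Fair.amplify (F : α → Bool) (β : ℝ) (j : ℕ) : Fair F (runAndCheck (amplify α β j)) := by
  intro x y hx hy
  rw [probResult_runAndCheck_some _ hx, probResult_runAndCheck_some _ hy,
    outcome_amplify_of_true β j hx hy]

theorem calls_amplify (β : ℝ) (j : ℕ) : (amplify α β j).calls = j := by
  simp [Circuit.calls, QuantumSearch.amplify]

end States

open Finset

/-! ### Failure probability of one randomized Grover round -/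

/-- The mean of `cos² ((2 j + 1) θ)` over `0 ≤ j < k`. -/
noncomputable def meanFail (θ : ℝ) (k : ℕ) : ℝ :=
  (∑ j ∈ range k, Real.cos ((2 * j + 1) * θ) ^ 2) / k

theorem meanFail_nonneg (θ : ℝ) (k : ℕ) : 0 ≤ meanFail θ k := by
  unfold meanFail
  positivity

theorem meanFail_le_one (θ : ℝ) (k : ℕ) : meanFail θ k ≤ 1 := by
  refine div_le_one_of_le₀ ?_ (by positivity)
  calc _ ≤ ∑ j ∈ range k, (1 : ℝ) := sum_le_sum fun j _ => Real.cos_sq_le_one _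
    _ = k := by simp

/-- After `cos² = (1 + cos 2·) / 2`, multiplying by `sin 2θ` makes the sum telescope. -/
theorem sum_cos_sq_mul_sin (θ : ℝ) (k : ℕ) :
    (∑ j ∈ range k, Real.cos ((2 * j + 1) * θ) ^ 2) * (4 * Real.sin (2 * θ)) =
      2 * k * Real.sin (2 * θ) + Real.sin (4 * k * θ) := by
  induction k with
  | zero => simp
  | succ k ih =>
    rw [sum_range_succ, add_mul, ih, Real.cos_sq]
    have h1 : Real.sin (4 * (k : ℝ) * θ) = Real.sin (2 * ((2 * k + 1) * θ) - 2 * θ) := by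
      congr 1; ring
    have h2 : Real.sin (4 * ((k + 1 : ℕ) : ℝ) * θ) =
        Real.sin (2 * ((2 * k + 1) * θ) + 2 * θ) := by
      congr 1; push_cast; ring
    rw [h1, h2, Real.sin_sub, Real.sin_add]
    push_cast
    ring

theorem meanFail_eq {θ : ℝ} (hθ : 0 < Real.sin (2 * θ)) {k : ℕ} (hk : 0 < k) :
    meanFail θ k = 1 / 2 + Real.sin (4 * k * θ) / (4 * k * Real.sin (2 * θ)) := by
  have h := sum_cos_sq_mul_sin θ k
  have hk0 : (0 : ℝ) < k := by exact_mod_cast hk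
  rw [meanFail]
  generalize Real.sin (4 * k * θ) = S at h ⊢
  field_simp
  linarith

theorem meanFail_le {θ : ℝ} (hθ : 0 < Real.sin (2 * θ)) {k : ℕ} (hk : 0 < k) :
    meanFail θ k ≤ 1 / 2 + 1 / (4 * k * Real.sin (2 * θ)) := by
  rw [meanFail_eq hθ hk]
  have hk0 : (0 : ℝ) < k := by exact_mod_cast hk
  gcongr
  exact Real.sin_le_one _

/-- Here `sin 2θ = 2 sin θ cos θ ≥ sin θ`, which replaces the double angle by the known quantity
`√(M/N)`. -/
theorem meanFail_le_of_half_le_cos {θ : ℝ} (hs : 0 < Real.sin θ) (hc : 1 / 2 ≤ Real.cos θ) {k : ℕ}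
    (hk : 0 < k) : meanFail θ k ≤ 1 / 2 + 1 / (4 * k * Real.sin θ) := by
  have hk0 : (0 : ℝ) < k := by exact_mod_cast hk
  have h2 : Real.sin θ ≤ Real.sin (2 * θ) := by
    rw [Real.sin_two_mul]
    nlinarith
  refine (meanFail_le (hs.trans_le h2) hk).trans ?_
  gcongr

/-- If the angle is close to `π / 2` then a small number of iterations succeeds with probability at
least `1 / 2`. -/
theorem meanFail_le_half {x : ℝ} (hx0 : 0 ≤ x) (hx : x < Real.pi) {k : ℕ} (hk : 0 < k)
    (hkx : 2 * k * x ≤ Real.pi) : meanFail ((Real.pi - x) / 2) k ≤ 1 / 2 := by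
  rcases hx0.eq_or_lt with rfl | hx0
  · rw [meanFail, sum_eq_zero]
    · norm_num
    · intro j _
      rw [sub_zero, show (2 * (j : ℝ) + 1) * (Real.pi / 2) = Real.pi / 2 + j * Real.pi by ring,
        Real.cos_add_nat_mul_pi, Real.cos_pi_div_two, mul_zero, zero_pow two_ne_zero]
  · have h2 : Real.sin (2 * ((Real.pi - x) / 2)) = Real.sin x := by
      rw [mul_div_cancel₀ _ two_ne_zero, Real.sin_pi_sub]
    have hs : 0 < Real.sin x := Real.sin_pos_of_pos_of_lt_pi hx0 hx
    -- Modulo `2π`, the angle `4kθ` is `-2kx`, so the correction to `1/2` has a favourable sign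
    -- while `2kx ≤ π`.
    rw [meanFail_eq (by rwa [h2]) hk, h2,
      show 4 * (k : ℝ) * ((Real.pi - x) / 2) = -(2 * k * x) + k * (2 * Real.pi) by ring,
      Real.sin_add_nat_mul_two_pi, Real.sin_neg]
    have h0 : 0 ≤ Real.sin (2 * k * x) := Real.sin_nonneg_of_nonneg_of_le_pi (by positivity) hkx
    have : 0 ≤ Real.sin (2 * k * x) / (4 * k * Real.sin x) := by positivity
    rw [neg_div]
    linarith

/-- Jordan's inequality `sin x ≥ 2x/π`, applied to `sin 2θ = sin x`. -/
theorem meanFail_le_of_pi_sub {x : ℝ} (hx0 : 0 < x) (hx : x ≤ Real.pi / 2) {k : ℕ} (hk : 0 < k) :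
    meanFail ((Real.pi - x) / 2) k ≤ 1 / 2 + Real.pi / (8 * k * x) := by
  have hk0 : (0 : ℝ) < k := by exact_mod_cast hk
  have h2 : Real.sin (2 * ((Real.pi - x) / 2)) = Real.sin x := by
    rw [mul_div_cancel₀ _ two_ne_zero, Real.sin_pi_sub]
  have hs := Real.mul_le_sin hx0.le hx
  have hs0 : 0 < 2 / Real.pi * x := by positivity
  refine (meanFail_le (by rw [h2]; linarith) hk).trans ?_
  rw [h2]
  calc (1 / 2 + 1 / (4 * k * Real.sin x) : ℝ) ≤ 1 / 2 + 1 / (4 * k * (2 / Real.pi * x)) := by gcongr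
    _ = _ := by field_simp; ring

theorem meanFail_le_three_quarters_of_pi_sub {x : ℝ} (hx0 : 0 ≤ x) (hx : x ≤ Real.pi / 2) {k : ℕ}
    (hk : 0 < k) : meanFail ((Real.pi - x) / 2) k ≤ 3 / 4 := by
  have hk0 : (0 : ℝ) < k := by exact_mod_cast hk
  rcases le_or_gt (2 * k * x) Real.pi with h | h
  · linarith [meanFail_le_half hx0 (by linarith [Real.pi_pos]) hk h]
  · have hx0 : 0 < x := by
      by_contra! h'
      nlinarith [Real.pi_pos]
    have : Real.pi / (8 * k * x) ≤ 1 / 4 := by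
      rw [div_le_iff₀ (by positivity)]
      linarith
    linarith [meanFail_le_of_pi_sub hx0 hx hk]

/-- The angle `θ ∈ (π / 3, π / 2]` in terms of its distance from `π / 2`. -/
theorem exists_eq_pi_sub_of_cos_lt_half {θ : ℝ} (h0 : 0 ≤ θ) (h1 : θ ≤ Real.pi / 2)
    (hc : Real.cos θ < 1 / 2) :
    ∃ x, 0 ≤ x ∧ x < Real.pi / 3 ∧ θ = (Real.pi - x) / 2 := by
  refine ⟨Real.pi - 2 * θ, by linarith, ?_, by ring⟩
  by_contra! h
  have := Real.cos_le_cos_of_nonneg_of_le_pi h0 (by linarith [Real.pi_pos])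
    (show θ ≤ Real.pi / 3 by linarith)
  rw [Real.cos_pi_div_three] at this
  linarith

/-- As soon as the number of iterations is taken from a range of length `1 / sin θ`, a round
succeeds with probability at least `1 / 4`. -/
theorem meanFail_le_three_quarters {θ : ℝ} (h0 : 0 < θ) (h1 : θ ≤ Real.pi / 2) {k : ℕ}
    (hk : 1 ≤ k * Real.sin θ) : meanFail θ k ≤ 3 / 4 := by
  have hs : 0 < Real.sin θ := Real.sin_pos_of_pos_of_lt_pi h0 (by linarith [Real.pi_pos])
  have hk0 : 0 < k := by
    rcases Nat.eq_zero_or_pos k with rfl | h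
    · norm_num at hk
    · exact h
  rcases le_or_gt (1 / 2) (Real.cos θ) with hc | hc
  · refine (meanFail_le_of_half_le_cos hs hc hk0).trans ?_
    have : 1 / (4 * k * Real.sin θ) ≤ 1 / 4 := by
      rw [mul_assoc]
      gcongr
      linarith
    linarith
  · obtain ⟨x, hx0, hx1, rfl⟩ := exists_eq_pi_sub_of_cos_lt_half h0.le h1 hc
    exact meanFail_le_three_quarters_of_pi_sub hx0 (by linarith [Real.pi_pos]) hk0

/-! ### Failure probability of BBHT -/

theorem growth_pos : 0 < growth := by norm_num [growth]

theorem one_lt_growth : 1 < growth := by norm_num [growth]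

theorem one_le_growth_pow (i : ℕ) : 1 ≤ growth ^ i := one_le_pow₀ one_lt_growth.le

theorem ceil_growth_pow_pos (i : ℕ) : 0 < ⌈growth ^ i⌉₊ :=
  Nat.ceil_pos.2 (pow_pos growth_pos i)

/-- The failure probability of *BBHT*. -/
noncomputable def bbhtFail (θ : ℝ) (N : ℕ) : ℝ :=
  ∏ i ∈ range (bbhtRounds N), meanFail θ ⌈growth ^ i⌉₊

/-- The source of the exponent: a factor `3/5` per round pays for the growth of `m ^ 1.86`. The 50th
power makes the exponent the integer `93`. -/
theorem growth_rpow_le : growth ^ (1.86 : ℝ) ≤ 5 / 3 := by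
  have h : (growth ^ (1.86 : ℝ)) ^ 50 ≤ (5 / 3) ^ 50 := by
    rw [← Real.rpow_natCast, ← Real.rpow_mul growth_pos.le,
      show (1.86 : ℝ) * ((50 : ℕ) : ℝ) = ((93 : ℕ) : ℝ) by norm_num, Real.rpow_natCast, growth]
    norm_num
  exact le_of_pow_le_pow_left₀ (by norm_num) (by norm_num) h

theorem three_fifths_pow_le {n : ℕ} {y : ℝ} (hy : 0 < y) (h : y ≤ growth ^ n) :
    (3 / 5 : ℝ) ^ n ≤ y ^ (-1.86 : ℝ) := by
  have h1 : y ^ (1.86 : ℝ) ≤ (5 / 3) ^ n := by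
    calc y ^ (1.86 : ℝ) ≤ (growth ^ n) ^ (1.86 : ℝ) := by gcongr
      _ = (growth ^ (1.86 : ℝ)) ^ n := by
          rw [Real.rpow_pow_comm growth_pos.le]
      _ ≤ _ := by
          have := growth_rpow_le
          have := Real.rpow_nonneg growth_pos.le 1.86
          gcongr
  rw [Real.rpow_neg hy.le, show (3 / 5 : ℝ) = (5 / 3)⁻¹ by norm_num, inv_pow]
  gcongr

theorem lt_growth_pow_bbhtRounds {N : ℕ} (hN : 0 < N) : 2 * √N < growth ^ bbhtRounds N := by
  by_contra! h
  exact lt_irrefl _ ((lt_bbhtRounds_iff hN _).2 h)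

/-- Rounds are counted backwards from the last one, whose `m` is just below `2√N`. The excess over
`1/2` then grows by the factor `growth` with each step back: the last `R` rounds fail with
probability at most `3/5`, four earlier ones are estimated individually, and all others by `1`. -/
theorem bbhtFail_le_of_half_le_cos {N M : ℕ} (hM : 2 ≤ M) (hMN : M ≤ N) {θ : ℝ}
    (hs : Real.sin θ = √((M : ℝ) / N)) (hc : 1 / 2 ≤ Real.cos θ) :
    bbhtFail θ N ≤ 0.7 * √M ^ (-1.86 : ℝ) := by
  have hN : 0 < N := by omega
  have hN0 : (0 : ℝ) < N := by exact_mod_cast hN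
  have hM0 : (2 : ℝ) ≤ M := by exact_mod_cast hM
  have hg := growth_pos
  have hNs : (0 : ℝ) < √N := Real.sqrt_pos.2 hN0
  have hMs : (1.4 : ℝ) ≤ √M := Real.le_sqrt_of_sq_le (by norm_num; linarith)
  have hle : √(M : ℝ) ≤ √N := Real.sqrt_le_sqrt (by exact_mod_cast hMN)
  rw [Real.sqrt_div' _ hN0.le] at hs
  have hs0 : 0 < Real.sin θ := by rw [hs]; positivity
  -- The factor `0.8` makes the excess `growth ^ (r+1) / (8√M)` at most `1/10` for `r < R`. The
  -- condition `M ≥ 2` is what makes `0.8 √M ≥ 1`.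
  obtain ⟨R, hR1, hR2⟩ := exists_nat_pow_near (show 1 ≤ 0.8 * √(M : ℝ) by linarith) one_lt_growth
  have hRL : R + 4 ≤ bbhtRounds N := by
    refine Nat.succ_le_of_lt ((lt_bbhtRounds_iff hN _).2 ?_)
    have : growth ^ (R + 3) = growth ^ R * 2.248091 := by rw [pow_add]; norm_num [growth]
    rw [this]
    linarith
  set b : ℕ → ℝ := fun r => meanFail θ ⌈growth ^ (bbhtRounds N - 1 - r)⌉₊ with hb
  have hb0 : ∀ r, 0 ≤ b r := fun r => meanFail_nonneg _ _
  have hprod : bbhtFail θ N = ∏ r ∈ range (bbhtRounds N), b r :=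
    (prod_range_reflect (fun i => meanFail θ ⌈growth ^ i⌉₊) _).symm
  have hb1 : ∀ r < bbhtRounds N, b r ≤ 1 / 2 + growth ^ (r + 1) / (8 * √M) := by
    intro r hr
    set m := bbhtRounds N - 1 - r with hm
    refine (meanFail_le_of_half_le_cos hs0 hc (ceil_growth_pow_pos _)).trans ?_
    have h1 : growth ^ m * growth ^ (r + 1) = growth ^ bbhtRounds N := by
      rw [← pow_add]; congr 1; omega
    have h2 := lt_growth_pow_bbhtRounds hN
    have h3 : growth ^ m ≤ (⌈growth ^ m⌉₊ : ℝ) := Nat.le_ceil _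
    have hgm : 0 < growth ^ m := pow_pos hg _
    have hgr : 0 < growth ^ (r + 1) := pow_pos hg _
    rw [add_le_add_iff_left, hs]
    calc (1 : ℝ) / (4 * ⌈growth ^ m⌉₊ * (√M / √N)) ≤ 1 / (4 * growth ^ m * (√M / √N)) := by gcongr
      _ = √N / (4 * growth ^ m * √M) := by field_simp
      _ ≤ _ := by
        rw [div_le_div_iff₀ (by positivity) (by positivity)]
        have : √N * (8 * √M) ≤ 4 * (growth ^ m * growth ^ (r + 1)) * √M := by
          rw [h1]
          nlinarith
        linarith
  have hsmall : ∀ r < R, b r ≤ 3 / 5 := by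
    intro r hr
    refine (hb1 r (by omega)).trans ?_
    have : growth ^ (r + 1) ≤ growth ^ R := pow_le_pow_right₀ one_lt_growth.le hr
    have : growth ^ (r + 1) / (8 * √M) ≤ 1 / 10 := by
      rw [div_le_iff₀ (by positivity)]
      linarith
    linarith
  have hlast : ∀ i < 4, b (R + i) ≤ 1 / 2 + growth ^ (i + 1) / 10 := by
    intro i hi
    refine (hb1 _ (by omega)).trans ?_
    have : growth ^ (R + i + 1) = growth ^ R * growth ^ (i + 1) := by ring
    rw [add_le_add_iff_left, this, div_le_iff₀ (by positivity)]
    have hgi : 0 < growth ^ (i + 1) := pow_pos hg _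
    nlinarith
  rw [hprod, ← Nat.add_sub_cancel' hRL, prod_range_add]
  have hrest : ∏ x ∈ range (bbhtRounds N - (R + 4)), b (R + 4 + x) ≤ 1 :=
    prod_le_one (fun _ _ => hb0 _) fun _ _ => meanFail_le_one _ _
  have hp0 : 0 ≤ ∏ x ∈ range (R + 4), b x := prod_nonneg fun _ _ => hb0 _
  refine (mul_le_of_le_one_right hp0 hrest).trans ?_
  have hR : ∏ x ∈ range R, b x ≤ (3 / 5) ^ R :=
    (prod_le_prod (fun _ _ => hb0 _) fun r hr => hsmall r (mem_range.1 hr)).trans (by simp [div_pow])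
  have h4 : ∏ i ∈ range 4, b (R + i) ≤ 0.245 := by
    refine (prod_le_prod (fun _ _ => hb0 _) fun i hi => hlast i (mem_range.1 hi)).trans ?_
    norm_num [prod_range_succ, growth]
  rw [prod_range_add]
  -- The upper bound on `0.8 √M` has exponent `R + 1`, which costs a factor `5/3`; the total
  -- constant is `0.245 · (5/3) · 1.5625 < 0.7`.
  have hpow := three_fifths_pow_le (by positivity) hR2.le
  have h08 : (0.8 * √(M : ℝ)) ^ (-1.86 : ℝ) ≤ 1.5625 * √M ^ (-1.86 : ℝ) := by
    rw [Real.mul_rpow (by norm_num) (by positivity)]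
    gcongr
    rw [show (0.8 : ℝ) = (1.25)⁻¹ by norm_num, Real.inv_rpow (by norm_num),
      ← Real.rpow_neg (by norm_num)]
    calc (1.25 : ℝ) ^ (-(-1.86) : ℝ) ≤ 1.25 ^ (2 : ℝ) :=
          Real.rpow_le_rpow_of_exponent_le (by norm_num) (by norm_num)
      _ ≤ 1.5625 := by norm_num
  have hR0 : 0 ≤ ∏ x ∈ range R, b x := prod_nonneg fun _ _ => hb0 _
  have h40 : 0 ≤ ∏ i ∈ range 4, b (R + i) := prod_nonneg fun _ _ => hb0 _
  have hpos : 0 ≤ √(M : ℝ) ^ (-1.86 : ℝ) := by positivity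
  rw [pow_succ] at hpow
  calc (∏ x ∈ range R, b x) * ∏ i ∈ range 4, b (R + i) ≤ (3 / 5) ^ R * 0.245 := by gcongr
    _ ≤ 0.7 * √M ^ (-1.86 : ℝ) := by linarith

/-- Near `π/2`, `sin 2θ` may be tiny, so the previous estimate is useless. With `x = π - 2θ`, rounds
with `2kx ≤ π` fail with probability at most `1/2`, and those with `k` much larger at most `3/5`.
Only six rounds in between need the weaker bound `3/4`, and the first round, a plain sample with
failure probability at most `1/4`, compensates for part of this loss. -/
theorem bbhtFail_le_of_cos_lt_half {N M : ℕ} (hM : 0 < M) (hMN : M ≤ N) {θ : ℝ}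
    (h0 : 0 ≤ θ) (h1 : θ ≤ Real.pi / 2) (hc : Real.cos θ < 1 / 2) :
    bbhtFail θ N ≤ 0.7 * √M ^ (-1.86 : ℝ) := by
  have hN : 0 < N := by omega
  have hN0 : (0 : ℝ) < N := by exact_mod_cast hN
  have hM0 : (0 : ℝ) < M := by exact_mod_cast hM
  have hg := growth_pos
  have hpi := Real.pi_pos
  have hle : √(M : ℝ) ≤ √N := Real.sqrt_le_sqrt (by exact_mod_cast hMN)
  have hfirst : meanFail θ ⌈growth ^ 0⌉₊ ≤ 1 / 4 := by
    have : 0 ≤ Real.cos θ := Real.cos_nonneg_of_neg_pi_div_two_le_of_le (by linarith) h1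
    simp only [meanFail, pow_zero, Nat.ceil_one, sum_range_one, Nat.cast_zero, mul_zero, zero_add,
      one_mul, Nat.cast_one, div_one]
    nlinarith
  obtain ⟨x, hx0, hx1, rfl⟩ := exists_eq_pi_sub_of_cos_lt_half h0 h1 hc
  set θ := (Real.pi - x) / 2 with hθ
  -- the rounds with failure probability above `3 / 5`
  obtain ⟨s, hs, hgood⟩ : ∃ s : ℕ, 1 ≤ s ∧ ∀ i, i < s ∨ s + 6 ≤ i →
      meanFail θ ⌈growth ^ i⌉₊ ≤ 3 / 5 := by
    classical
    by_cases hex : ∃ i : ℕ, Real.pi < 2 * ⌈growth ^ i⌉₊ * x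
    · refine ⟨Nat.find hex, ?_, ?_⟩
      · rw [Nat.one_le_iff_ne_zero, Ne, Nat.find_eq_zero]
        simp only [pow_zero, Nat.ceil_one, Nat.cast_one]
        linarith
      · have hspec := Nat.find_spec hex
        set s := Nat.find hex with hsdef
        rintro i (hi | hi)
        · have := Nat.find_min hex hi
          linarith [meanFail_le_half hx0 (by linarith) (ceil_growth_pow_pos i) (not_lt.1 this)]
        · have hks : (⌈growth ^ s⌉₊ : ℝ) < growth ^ s + 1 := Nat.ceil_lt_add_one (by positivity)
          have hki : growth ^ i ≤ (⌈growth ^ i⌉₊ : ℝ) := Nat.le_ceil _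
          -- Six rounds later `m` is at least five times as large. With `π < 2 ⌈growth ^ s⌉₊ x < 4
          -- growth ^ s x` this gives `8kx > 10π`, hence an excess below `1/10`.
          have hsi : growth ^ s * 5 ≤ growth ^ i := by
            calc growth ^ s * 5 ≤ growth ^ s * growth ^ 6 := by
                  gcongr; norm_num [growth]
              _ = growth ^ (s + 6) := (pow_add _ _ _).symm
              _ ≤ growth ^ i := pow_le_pow_right₀ one_lt_growth.le hi
          have h1s := one_le_growth_pow s
          have hxpos : 0 < x := by
            by_contra! h'
            nlinarith
          have hi0 : (0 : ℝ) < ⌈growth ^ i⌉₊ := by exact_mod_cast ceil_growth_pow_pos i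
          refine (meanFail_le_of_pi_sub hxpos (by linarith) (ceil_growth_pow_pos i)).trans ?_
          have : Real.pi / (8 * ⌈growth ^ i⌉₊ * x) ≤ 1 / 10 := by
            rw [div_le_iff₀ (by positivity)]
            nlinarith
          linarith
    · push Not at hex
      exact ⟨1, le_rfl, fun i _ => by
        linarith [meanFail_le_half hx0 (by linarith) (ceil_growth_pow_pos i) (hex i)]⟩
  -- Relative to `3/5`, the first round has factor `5/12` and a bad round `5/4`. Since `s ≥ 1`, the
  -- first round is never a bad one.
  have hterm : ∀ i ∈ range (bbhtRounds N), meanFail θ ⌈growth ^ i⌉₊ ≤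
      3 / 5 * ((if i = 0 then 5 / 12 else 1) * if s ≤ i ∧ i < s + 6 then 5 / 4 else 1) := by
    intro i _
    by_cases hi : s ≤ i ∧ i < s + 6
    · rw [if_pos hi, if_neg (by omega)]
      linarith [meanFail_le_three_quarters_of_pi_sub hx0 (by linarith) (ceil_growth_pow_pos i)]
    · rw [if_neg hi]
      by_cases hi0 : i = 0
      · subst hi0
        norm_num at hfirst ⊢
        exact hfirst
      · rw [if_neg hi0]
        linarith [hgood i (by omega)]
  refine (prod_le_prod (fun _ _ => meanFail_nonneg _ _) hterm).trans ?_
  rw [prod_mul_distrib, prod_mul_distrib, prod_const, card_range, prod_ite_eq' , prod_ite,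
    prod_const, prod_const_one, mul_one,
    if_pos (mem_range.2 (show 0 < bbhtRounds N by rw [bbhtRounds]; omega))]
  have hcard : #{i ∈ range (bbhtRounds N) | s ≤ i ∧ i < s + 6} ≤ 6 := by
    calc _ ≤ #(Ico s (s + 6)) := card_le_card fun i hi => by
          simpa using (mem_filter.1 hi).2
      _ = 6 := by simp
  have hpow := three_fifths_pow_le (by positivity) (lt_growth_pow_bbhtRounds hN).le
  have h2 : (2 * √(N : ℝ)) ^ (-1.86 : ℝ) ≤ 0.36 * √M ^ (-1.86 : ℝ) := by
    rw [Real.mul_rpow (by norm_num) (by positivity)]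
    have h22 : (2 : ℝ) ^ (-1.86 : ℝ) ≤ 0.36 := by
      calc (2 : ℝ) ^ (-1.86 : ℝ) ≤ 2 ^ (-(3 / 2) : ℝ) :=
            Real.rpow_le_rpow_of_exponent_le (by norm_num) (by norm_num)
        _ ≤ 0.36 := by
          refine le_of_pow_le_pow_left₀ two_ne_zero (by norm_num) ?_
          rw [← Real.rpow_natCast, ← Real.rpow_mul (by norm_num)]
          norm_num
    have hNM : √(N : ℝ) ^ (-1.86 : ℝ) ≤ √M ^ (-1.86 : ℝ) :=
      Real.rpow_le_rpow_of_nonpos (by positivity) hle (by norm_num)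
    gcongr
  have h6 : (5 / 4 : ℝ) ^ #{i ∈ range (bbhtRounds N) | s ≤ i ∧ i < s + 6} ≤ (5 / 4) ^ 6 :=
    pow_le_pow_right₀ (by norm_num) hcard
  have hpos : 0 ≤ √(M : ℝ) ^ (-1.86 : ℝ) := by positivity
  calc _ ≤ (0.36 * √(M : ℝ) ^ (-1.86 : ℝ)) * (5 / 12 * (5 / 4) ^ 6) := by
        gcongr
        exact hpow.trans h2
    _ ≤ _ := by nlinarith

theorem bbhtFail_nonneg (θ : ℝ) (N : ℕ) : 0 ≤ bbhtFail θ N :=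
  prod_nonneg fun _ _ => meanFail_nonneg _ _

theorem bbhtFail_le_one (θ : ℝ) (N : ℕ) : bbhtFail θ N ≤ 1 :=
  prod_le_one (fun _ _ => meanFail_nonneg _ _) fun _ _ => meanFail_le_one _ _


/-! ### Randomized rounds of Grover's algorithm -/

theorem list_range_prod {R : Type*} [CommMonoid R] (f : ℕ → R) (n : ℕ) :
    ((List.range n).map f).prod = ∏ i ∈ range n, f i := by
  induction n with
  | zero => simp
  | succ n ih => rw [List.range_succ, List.map_append, List.prod_append, ih, prod_range_succ]; simp

theorem list_range_sum (f : ℕ → ℝ) (n : ℕ) :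
    ((List.range n).map f).sum = ∑ i ∈ range n, f i := by
  induction n with
  | zero => simp
  | succ n ih => rw [List.range_succ, List.map_append, List.sum_append, ih, sum_range_succ]; simp

section Searches

variable {α : Type u} [Fintype α] [Nonempty α] (F : α → Bool)

theorem failProb_groverRound {m : ℝ} (hm : 0 < m) :
    failProb F (groverRound α m) = ENNReal.ofReal (meanFail (groverAngle F) ⌈m⌉₊) := by
  have hk : ⌈m⌉₊ - 1 + 1 = ⌈m⌉₊ := Nat.sub_add_cancel (Nat.ceil_pos.2 hm)
  have hk0 : (0 : ℝ) < ⌈m⌉₊ := by exact_mod_cast Nat.ceil_pos.2 hm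
  rw [failProb, groverRound, probResult_uniform,
    sum_congr rfl fun (i : Fin _) _ => show probResult _ none = _ from failProb_grover F i,
    ← ENNReal.ofReal_sum_of_nonneg fun i _ => sq_nonneg _,
    Fin.sum_univ_eq_sum_range (fun j : ℕ => Real.cos ((2 * j + 1) * groverAngle F) ^ 2), hk,
    meanFail, div_eq_inv_mul, ENNReal.ofReal_mul (by positivity), ENNReal.ofReal_inv_of_pos hk0,
    ENNReal.ofReal_natCast]

variable {F}

/-- With the checking call, `j + 1 ≤ ⌈m⌉ < m + 1 ≤ 2m`. -/
theorem CallsLE.groverRound {m : ℝ} (hm : 1 ≤ m) : CallsLE F (groverRound α m) (2 * m) := by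
  refine CallsLE.uniform fun i => (CallsLE.runAndCheck _).mono ?_
  rw [grover, calls_amplify]
  have h1 : ⌈m⌉₊ - 1 + 1 = ⌈m⌉₊ := Nat.sub_add_cancel (Nat.ceil_pos.2 (by linarith))
  have h2 : ((i : ℕ) : ℝ) + 1 ≤ ⌈m⌉₊ := by
    have := i.2
    exact_mod_cast (by omega : (i : ℕ) + 1 ≤ ⌈m⌉₊)
  have h3 := Nat.ceil_lt_add_one (show 0 ≤ m by linarith)
  linarith

theorem Sound.groverRound (m : ℝ) : Sound F (groverRound α m) :=
  Sound.uniform fun _ => Sound.runAndCheck _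

theorem Fair.groverRound (m : ℝ) : Fair F (groverRound α m) :=
  Fair.uniform fun _ => Fair.amplify F _ _

/-! ### BBHT -/

theorem failProb_bbht :
    failProb F (bbht α) = ENNReal.ofReal (bbhtFail (groverAngle F) (Fintype.card α)) := by
  rw [bbht, failProb_firstSuccess, List.map_map, list_range_prod, bbhtFail,
    ENNReal.ofReal_prod_of_nonneg fun i _ => meanFail_nonneg _ _]
  exact prod_congr rfl fun i _ => failProb_groverRound F (pow_pos growth_pos i)

theorem Sound.bbht : Sound F (bbht α) := Sound.firstSuccess fun p hp => by
  obtain ⟨i, -, rfl⟩ := List.mem_map.1 hp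
  exact Sound.groverRound _

theorem Fair.bbht : Fair F (bbht α) := Fair.firstSuccess fun p hp => by
  obtain ⟨i, -, rfl⟩ := List.mem_map.1 hp
  exact Fair.groverRound _

theorem CallsLE.bbht : CallsLE F (bbht α) (18 * √(Fintype.card α)) := by
  have h := CallsLE.map_append (F := F) (l := List.range (bbhtRounds (Fintype.card α)))
    (f := fun k => QuantumSearch.groverRound α (growth ^ k)) (c := fun k => 2 * growth ^ k)
    (fun i _ => ⟨CallsLE.groverRound (one_le_growth_pow i), by have := growth_pos; positivity⟩)
    CallsLE.nil le_rfl
  rw [List.append_nil] at h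
  refine h.mono ?_
  have hL : growth ^ ⌊Real.logb growth (2 * √(Fintype.card α))⌋₊ ≤ 2 * √(Fintype.card α) :=
    (lt_bbhtRounds_iff Fintype.card_pos _).1 (Nat.lt_succ_self _)
  rw [add_zero, list_range_sum, ← mul_sum, geom_sum_eq one_lt_growth.ne', bbhtRounds, pow_succ]
  rw [mul_div_assoc', div_le_iff₀ (by linarith [one_lt_growth])]
  generalize growth ^ ⌊Real.logb growth (2 * √(Fintype.card α))⌋₊ = g at hL
  norm_num [growth]
  linarith [Real.sqrt_nonneg (Fintype.card α : ℝ)]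

/-- A bound for the expected number of calls that *BBHT* still makes when `m` has reached
`growth ^ i`, where `q = √(N / M)`. -/
noncomputable def bbhtPotential (q : ℝ) (i : ℕ) : ℝ :=
  if q ≤ growth ^ i then 115 * growth ^ i else 160 * q - 7 * growth ^ i

theorem bbhtPotential_nonneg (q : ℝ) (i : ℕ) : 0 ≤ bbhtPotential q i := by
  have := one_le_growth_pow i
  unfold bbhtPotential
  split_ifs <;> linarith

/-- Beyond `q` the expected costs decay geometrically because `3/4 · growth = 0.9825 < 1`; the
constant must be at least `2 / 0.0175`, whence `115`. Below `q` failure is not bounded away from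
`1`, and the term `-7 growth ^ i` pays for the round, as `7 · 0.31 ≥ 2`. The constant `160` covers
the passage from one regime to the other. -/
theorem bbhtPotential_step {q a : ℝ} {i : ℕ} (ha : a ≤ 1) (h : q ≤ growth ^ i → a ≤ 3 / 4) :
    2 * growth ^ i + a * bbhtPotential q (i + 1) ≤ bbhtPotential q i := by
  have h0 := bbhtPotential_nonneg q (i + 1)
  have h1 := one_le_growth_pow i
  rcases le_or_gt q (growth ^ i) with hi | hi
  · have h2 : a * bbhtPotential q (i + 1) ≤ 3 / 4 * bbhtPotential q (i + 1) := by
      gcongr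
      exact h hi
    refine (add_le_add_right h2 _).trans ?_
    rw [bbhtPotential, bbhtPotential, if_pos hi,
      if_pos (hi.trans (pow_le_pow_right₀ one_lt_growth.le i.le_succ)), pow_succ]
    generalize growth ^ i = g at *
    norm_num [growth]
    linarith
  · refine (add_le_add_right (mul_le_of_le_one_left h0 ha) _).trans ?_
    rw [bbhtPotential, bbhtPotential, if_neg hi.not_ge, pow_succ]
    generalize growth ^ i = g at *
    norm_num [growth]
    split_ifs <;> linarith

theorem groverAngle_pos (hM : 0 < numSolutions F) : 0 < groverAngle F := by
  have hN : (0 : ℝ) < Fintype.card α := by exact_mod_cast Fintype.card_pos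
  have hM0 : (0 : ℝ) < numSolutions F := by exact_mod_cast hM
  exact Real.arcsin_pos.2 (by positivity)

theorem meanFail_groverAngle_le (hM : 0 < numSolutions F) {m : ℝ}
    (hm : √((Fintype.card α : ℝ) / numSolutions F) ≤ m) :
    meanFail (groverAngle F) ⌈m⌉₊ ≤ 3 / 4 := by
  have hN : (0 : ℝ) < Fintype.card α := by exact_mod_cast Fintype.card_pos
  have hM0 : (0 : ℝ) < numSolutions F := by exact_mod_cast hM
  refine meanFail_le_three_quarters (groverAngle_pos hM) (Real.arcsin_le_pi_div_two _) ?_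
  rw [sin_groverAngle, ← inv_div, Real.sqrt_inv, ← div_eq_mul_inv, one_le_div (by positivity)]
  exact hm.trans (Nat.le_ceil m)

theorem expectedCalls_bbht_le (hM : 0 < numSolutions F) :
    expectedCalls ((bbht α).eval F) ≤
      ENNReal.ofReal (160 * √((Fintype.card α : ℝ) / numSolutions F)) := by
  have hM0 : (0 : ℝ) < numSolutions F := by exact_mod_cast hM
  set q := √((Fintype.card α : ℝ) / numSolutions F) with hq
  have hq1 : 1 ≤ q := by
    rw [hq, Real.one_le_sqrt, one_le_div hM0]
    exact_mod_cast numSolutions_le_card F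
  -- The induction runs over all tails of the loop; stopping early costs nothing because the
  -- potential is nonnegative.
  have key : ∀ n i, expectedCalls ((firstSuccess ((List.range' i n).map fun k =>
      QuantumSearch.groverRound α (growth ^ k))).eval F) ≤ ENNReal.ofReal (bbhtPotential q i) := by
    intro n
    induction n with
    | zero => intro i; simp [expectedCalls_nil]
    | succ n ih =>
      intro i
      have hg := pow_pos growth_pos i
      rw [List.range'_succ, List.map_cons, expectedCalls_cons, failProb_groverRound F hg]
      refine (add_le_add (CallsLE.groverRound (one_le_growth_pow i)).expectedCalls_le
        (mul_le_mul_right (ih (i + 1)) _)).trans ?_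
      rw [← ENNReal.ofReal_mul (meanFail_nonneg _ _), ← ENNReal.ofReal_add (by positivity)
        (mul_nonneg (meanFail_nonneg _ _) (bbhtPotential_nonneg _ _))]
      exact ENNReal.ofReal_le_ofReal
        (bbhtPotential_step (meanFail_le_one _ _) (meanFail_groverAngle_le hM))
  rw [bbht, List.range_eq_range']
  refine (key _ 0).trans (ENNReal.ofReal_le_ofReal ?_)
  rw [bbhtPotential]
  simp only [pow_zero]
  split_ifs <;> linarith

/-- The first bound weights the cost of BCWZ and is needed for every `M`; at `M = 1` it is trivial.
The second serves the failure probability, where only `M ≥ 2` matters. -/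
theorem bbhtFail_sq_le (hM : 0 < numSolutions F) :
    bbhtFail (groverAngle F) (Fintype.card α) ^ 2 ≤ (numSolutions F : ℝ) ^ (-1.86 : ℝ) ∧
      (2 ≤ numSolutions F → bbhtFail (groverAngle F) (Fintype.card α) ^ 2 ≤
        0.49 * (numSolutions F : ℝ) ^ (-1.86 : ℝ)) := by
  have h0 := bbhtFail_nonneg (groverAngle F) (Fintype.card α)
  have hpos : 0 ≤ (numSolutions F : ℝ) ^ (-1.86 : ℝ) := by positivity
  have h2 : 2 ≤ numSolutions F → bbhtFail (groverAngle F) (Fintype.card α) ^ 2 ≤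
        0.49 * (numSolutions F : ℝ) ^ (-1.86 : ℝ) := by
    intro h
    have hle : bbhtFail (groverAngle F) (Fintype.card α) ≤
        0.7 * √(numSolutions F) ^ (-1.86 : ℝ) := by
      rcases le_or_gt (1 / 2) (Real.cos (groverAngle F)) with hc | hc
      · exact bbhtFail_le_of_half_le_cos h (numSolutions_le_card F) (sin_groverAngle F) hc
      · exact bbhtFail_le_of_cos_lt_half hM (numSolutions_le_card F) (groverAngle_pos hM).le
          (Real.arcsin_le_pi_div_two _) hc
    calc bbhtFail (groverAngle F) (Fintype.card α) ^ 2
        ≤ (0.7 * √(numSolutions F : ℝ) ^ (-1.86 : ℝ)) ^ 2 := by gcongr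
      _ = 0.49 * (numSolutions F : ℝ) ^ (-1.86 : ℝ) := by
        rw [mul_pow, Real.rpow_pow_comm (Real.sqrt_nonneg _), Real.sq_sqrt (by positivity)]
        norm_num
  refine ⟨?_, h2⟩
  rcases Nat.lt_or_ge (numSolutions F) 2 with h | h
  · rw [show numSolutions F = 1 by omega, Nat.cast_one, Real.one_rpow]
    exact pow_le_one₀ h0 (bbhtFail_le_one _ _)
  · linarith [h2 h]

/-! ### BCWZ -/

theorem exactIter_add_one_le {N t : ℕ} (ht : 0 < t) (hN : t ≤ N) :
    (exactIter N t : ℝ) + 1 ≤ 3 * √((N : ℝ) / t) := by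
  have hN0 : (0 : ℝ) < N := by exact_mod_cast ht.trans_le hN
  have ht0 : (0 : ℝ) < t := by exact_mod_cast ht
  have htN : (t : ℝ) ≤ N := by exact_mod_cast hN
  have hs1 : √((t : ℝ) / N) ≤ 1 := Real.sqrt_le_one.2 (div_le_one_of_le₀ htN hN0.le)
  have hs0 : 0 < √((t : ℝ) / N) := by positivity
  rw [exactIter, ← inv_div (t : ℝ), Real.sqrt_inv]
  set s := √((t : ℝ) / N)
  have h0 : 0 < Real.arcsin s := Real.arcsin_pos.2 hs0
  have h1 : s ≤ Real.arcsin s := by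
    simpa [Real.sin_arcsin (by linarith) hs1] using Real.sin_le h0.le
  have h2 : 1 / 2 ≤ Real.pi / (4 * Real.arcsin s) := by
    rw [div_le_div_iff₀ two_pos (by positivity)]
    linarith [Real.arcsin_le_pi_div_two s]
  have h3 : Real.pi / (4 * Real.arcsin s) ≤ s⁻¹ := by
    rw [div_le_iff₀ (by positivity), ← div_eq_inv_mul, le_div_iff₀ hs0]
    nlinarith [Real.pi_lt_four]
  have h4 : 1 ≤ s⁻¹ := (one_le_inv₀ hs0).2 hs1
  linarith [Nat.ceil_lt_add_one (sub_nonneg.2 h2)]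

/-- Each term is at most `2 (√(i+1) - √i)`, and these differences telescope. -/
theorem sum_inv_sqrt_le (n : ℕ) : ∑ i ∈ range n, (√((i + 1 : ℕ) : ℝ))⁻¹ ≤ 2 * √n := by
  induction n with
  | zero => simp
  | succ n ih =>
    rw [sum_range_succ]
    refine (add_le_add_left ih _).trans ?_
    have h1 : √((n + 1 : ℕ) : ℝ) ^ 2 = n + 1 := by
      rw [Real.sq_sqrt (by positivity)]; push_cast; ring
    have h2 : √(n : ℝ) ^ 2 = n := Real.sq_sqrt (by positivity)
    have h3 : 0 < √((n + 1 : ℕ) : ℝ) := by positivity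
    rw [← le_sub_iff_add_le', inv_le_iff_one_le_mul₀ h3]
    nlinarith [sq_nonneg (√((n + 1 : ℕ) : ℝ) - √n)]

theorem Sound.bcwz (ε : ℝ) : Sound F (bcwz α ε) := Sound.firstSuccess fun p hp => by
  rcases List.mem_append.1 hp with hp | hp
  · obtain ⟨i, -, rfl⟩ := List.mem_map.1 hp
    exact Sound.runAndCheck _
  · rw [List.eq_of_mem_replicate hp]
    refine Sound.firstSuccess fun p hp => ?_
    rw [List.eq_of_mem_replicate hp]
    exact Sound.groverRound _

theorem Fair.bcwz (ε : ℝ) : Fair F (bcwz α ε) := Fair.firstSuccess fun p hp => by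
  rcases List.mem_append.1 hp with hp | hp
  · obtain ⟨i, -, rfl⟩ := List.mem_map.1 hp
    exact Fair.amplify F _ _
  · rw [List.eq_of_mem_replicate hp]
    refine Fair.firstSuccess fun p hp => ?_
    rw [List.eq_of_mem_replicate hp]
    exact Fair.groverRound _

/-- The exact searches cost `∑ 3√(N/i) ≤ 6√(N t₀)`, and the randomized ones `t₀ · 3 · 2√(N/t₀) =
6√(N t₀)`. -/
theorem CallsLE.bcwz {ε : ℝ} (hε : 0 < bcwzCutoff (Fintype.card α) ε) :
    CallsLE F (bcwz α ε)
      (12 * √((Fintype.card α : ℝ) * bcwzCutoff (Fintype.card α) ε)) := by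
  have hle : bcwzCutoff (Fintype.card α) ε ≤ Fintype.card α := min_le_left _ _
  rw [QuantumSearch.bcwz]
  generalize bcwzCutoff (Fintype.card α) ε = t at *
  have ht0 : (0 : ℝ) < t := by exact_mod_cast hε
  have h1 : 1 ≤ √((Fintype.card α : ℝ) / t) := by
    rw [Real.one_le_sqrt, one_le_div ht0]
    exact_mod_cast hle
  have h3 : CallsLE F (QuantumSearch.firstSuccess (List.replicate 3
      (QuantumSearch.groverRound α √((Fintype.card α : ℝ) / t)))) _ :=
    (CallsLE.groverRound h1).replicate (by positivity) 3
  refine (CallsLE.map_append (l := List.range t)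
    (c := fun i => 3 * √((Fintype.card α : ℝ) / (i + 1 : ℕ)))
    (fun i hi => ⟨(CallsLE.runAndCheck _).mono ?_, by positivity⟩)
    (h3.replicate (by positivity) t) (by positivity)).mono ?_
  · rw [exactGrover, calls_amplify]
    exact exactIter_add_one_le i.succ_pos ((List.mem_range.1 hi).trans_le hle)
  · have hs : √(t : ℝ) * √t = t := Real.mul_self_sqrt ht0.le
    have ht : 0 < √(t : ℝ) := by positivity
    have e : ∀ i : ℕ, 3 * √((Fintype.card α : ℝ) / (i + 1 : ℕ)) =
        3 * √(Fintype.card α) * (√((i + 1 : ℕ) : ℝ))⁻¹ := fun i => by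
      rw [Real.sqrt_div (by positivity)]; ring
    rw [list_range_sum, sum_congr rfl fun i _ => e i, ← mul_sum, Real.sqrt_mul (by positivity),
      Real.sqrt_div (by positivity)]
    have h4 : (t : ℝ) * (((3 : ℕ) : ℝ) * (2 * (√(Fintype.card α : ℝ) / √t))) =
        6 * √(Fintype.card α) * √t := by
      nth_rw 1 [← hs]
      field_simp
      norm_num
    have h5 : 3 * √(Fintype.card α : ℝ) * ∑ i ∈ range t, (√((i + 1 : ℕ) : ℝ))⁻¹ ≤
        3 * √(Fintype.card α) * (2 * √t) := by
      gcongr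
      exact sum_inv_sqrt_le t
    rw [h4]
    linarith

theorem failProb_bcwz_of_le {ε : ℝ} (hM : 0 < numSolutions F)
    (h : numSolutions F ≤ bcwzCutoff (Fintype.card α) ε) : failProb F (bcwz α ε) = 0 := by
  rw [bcwz, failProb_firstSuccess, List.map_append, List.prod_append]
  refine mul_eq_zero_of_left (List.prod_eq_zero_iff.2 ?_) _
  rw [List.map_map, List.mem_map]
  refine ⟨numSolutions F - 1, List.mem_range.2 (by omega), ?_⟩
  rw [Function.comp_apply, Nat.sub_add_cancel hM, failProb_exactGrover F hM]

theorem failProb_bcwz_le {ε : ℝ} (hε : 0 < ε) (ht : 0 < bcwzCutoff (Fintype.card α) ε)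
    (h : bcwzCutoff (Fintype.card α) ε < numSolutions F) :
    failProb F (bcwz α ε) ≤ ENNReal.ofReal ε := by
  have hM := ht.trans h
  have hlt := h.trans_le (numSolutions_le_card F)
  -- The cutoff is below `M ≤ N`, so the minimum is not attained by `N` and there are enough
  -- searches to reach `ε`.
  have hcut : bcwzCutoff (Fintype.card α) ε = ⌈Real.logb 2 ε⁻¹⌉₊ := by
    unfold bcwzCutoff at hlt ⊢
    omega
  rw [bcwz, failProb_firstSuccess, List.map_append, List.prod_append]
  set t := bcwzCutoff (Fintype.card α) ε with htdef
  have ht0 : (0 : ℝ) < t := by exact_mod_cast ht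
  have hN : (0 : ℝ) < Fintype.card α := by exact_mod_cast Fintype.card_pos
  have h1 : ((List.map (fun i => runAndCheck (exactGrover α (i + 1))) (List.range t)).map
      (failProb F)).prod ≤ 1 := by
    rw [← failProb_firstSuccess]
    exact failProb_le_one F _
  refine (mul_le_of_le_one_left' h1).trans ?_
  rw [List.map_replicate, List.prod_replicate, failProb_firstSuccess, List.map_replicate,
    List.prod_replicate, failProb_groverRound F (by positivity),
    ← ENNReal.ofReal_pow (meanFail_nonneg _ _),
    ← ENNReal.ofReal_pow (pow_nonneg (meanFail_nonneg _ _) _)]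
  refine ENNReal.ofReal_le_ofReal ?_
  have h2 : meanFail (groverAngle F) ⌈√((Fintype.card α : ℝ) / t)⌉₊ ≤ 3 / 4 :=
    meanFail_groverAngle_le hM (Real.sqrt_le_sqrt (by gcongr))
  have h0 := meanFail_nonneg (groverAngle F) ⌈√((Fintype.card α : ℝ) / t)⌉₊
  -- Three rounds per search suffice because `(3/4)³ = 27/64 ≤ 1/2`.
  calc (meanFail (groverAngle F) ⌈√((Fintype.card α : ℝ) / t)⌉₊ ^ 3) ^ t
      ≤ ((3 / 4) ^ 3) ^ t := by gcongr
    _ ≤ (1 / 2) ^ t := by gcongr; norm_num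
    _ ≤ ε := by
      rw [one_div, inv_pow, inv_le_comm₀ (by positivity) hε, ← Real.rpow_natCast]
      have : Real.logb 2 ε⁻¹ ≤ t := by rw [hcut]; exact Nat.le_ceil _
      rwa [Real.logb_le_iff_le_rpow one_lt_two (by positivity)] at this

/-! ### findsol -/

theorem Sound.findsol (ε : ℝ) : Sound F (findsol α ε) := Sound.firstSuccess fun p hp => by
  simp only [List.mem_cons, List.not_mem_nil, or_false] at hp
  rcases hp with rfl | rfl | rfl
  exacts [Sound.bbht, Sound.bbht, Sound.bcwz ε]

theorem Fair.findsol (ε : ℝ) : Fair F (findsol α ε) := Fair.firstSuccess fun p hp => by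
  simp only [List.mem_cons, List.not_mem_nil, or_false] at hp
  rcases hp with rfl | rfl | rfl
  exacts [Fair.bbht, Fair.bbht, Fair.bcwz ε]

theorem failProb_findsol (ε : ℝ) :
    failProb F (findsol α ε) =
      ENNReal.ofReal (bbhtFail (groverAngle F) (Fintype.card α) ^ 2) * failProb F (bcwz α ε) := by
  rw [findsol, failProb_firstSuccess, ENNReal.ofReal_pow (bbhtFail_nonneg _ _)]
  simp only [List.map_cons, List.map_nil, List.prod_cons, List.prod_nil, mul_one, failProb_bbht]
  ring

/-- Either an exact search makes failure impossible, or `M` exceeds a cutoff that is at least `1`.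
In the second case `M ≥ 2`, and `0.49 < 0.5` gives strictness. -/
theorem failProb_findsol_lt {ε : ℝ} (hε : 0 < ε) (ht : 0 < bcwzCutoff (Fintype.card α) ε)
    (hM : 0 < numSolutions F) :
    failProb F (findsol α ε) <
      ENNReal.ofReal (0.5 * (numSolutions F : ℝ) ^ (-1.86 : ℝ) * ε) := by
  have hM0 : (0 : ℝ) < numSolutions F := by exact_mod_cast hM
  have hpos : 0 < (numSolutions F : ℝ) ^ (-1.86 : ℝ) := by positivity
  rw [failProb_findsol]
  rcases le_or_gt (numSolutions F) (bcwzCutoff (Fintype.card α) ε) with h | h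
  · rw [failProb_bcwz_of_le hM h, mul_zero, ENNReal.ofReal_pos]
    positivity
  · refine (mul_le_mul_right (failProb_bcwz_le hε ht h) _).trans_lt ?_
    rw [← ENNReal.ofReal_mul (sq_nonneg _), ENNReal.ofReal_lt_ofReal_iff (by positivity)]
    have := (bbhtFail_sq_le hM).2 (by omega)
    gcongr
    linarith

theorem CallsLE.findsol {ε : ℝ} (hε : 0 < bcwzCutoff (Fintype.card α) ε) :
    CallsLE F (findsol α ε) (36 * √(Fintype.card α) +
      12 * √((Fintype.card α : ℝ) * bcwzCutoff (Fintype.card α) ε)) := by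
  refine (CallsLE.bbht.cons (CallsLE.bbht.cons ((CallsLE.bcwz hε).cons CallsLE.nil le_rfl)
    (by positivity)) (by positivity)).mono ?_
  linarith

theorem expectedCalls_findsol_le {ε : ℝ} (hε : 0 < bcwzCutoff (Fintype.card α) ε)
    (hM : 0 < numSolutions F) :
    expectedCalls ((findsol α ε).eval F) ≤
      ENNReal.ofReal (320 * √((Fintype.card α : ℝ) / numSolutions F) +
        12 * √((Fintype.card α : ℝ) * bcwzCutoff (Fintype.card α) ε) *
          (numSolutions F : ℝ) ^ (-1.86 : ℝ)) := by
  have h0 := bbhtFail_nonneg (groverAngle F) (Fintype.card α)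
  have h1 := bbhtFail_le_one (groverAngle F) (Fintype.card α)
  have h2 := (bbhtFail_sq_le hM).1
  have hb := expectedCalls_bbht_le hM
  have hc := (CallsLE.bcwz (F := F) hε).expectedCalls_le
  rw [findsol, expectedCalls_cons, expectedCalls_cons, expectedCalls_cons, expectedCalls_nil,
    mul_zero, add_zero, failProb_bbht]
  generalize bbhtFail (groverAngle F) (Fintype.card α) = f at *
  set q := √((Fintype.card α : ℝ) / numSolutions F)
  set S := √((Fintype.card α : ℝ) * bcwzCutoff (Fintype.card α) ε)
  have hq : 0 ≤ q := Real.sqrt_nonneg _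
  have hS : 0 ≤ S := Real.sqrt_nonneg _
  calc _ ≤ ENNReal.ofReal (160 * q) + ENNReal.ofReal f *
        (ENNReal.ofReal (160 * q) + ENNReal.ofReal f * ENNReal.ofReal (12 * S)) := by gcongr
    _ = ENNReal.ofReal (160 * q + f * (160 * q + f * (12 * S))) := by
        rw [← ENNReal.ofReal_mul h0, ← ENNReal.ofReal_add (by positivity) (by positivity),
          ← ENNReal.ofReal_mul h0, ← ENNReal.ofReal_add (by positivity) (by positivity)]
    _ ≤ _ := by
        refine ENNReal.ofReal_le_ofReal ?_
        have h3 : f * (160 * q) ≤ 160 * q := mul_le_of_le_one_left (by positivity) h1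
        have h4 : 12 * S * f ^ 2 ≤ 12 * S * (numSolutions F : ℝ) ^ (-1.86 : ℝ) := by gcongr
        linarith

end Searches

/-! ### Comparison of the cutoff with `lg ε⁻¹`, and the final constant -/

theorem bcwzCutoff_pos {N : ℕ} {ε : ℝ} (hN : 0 < N) (hε : 0 < Real.logb 2 ε⁻¹) :
    0 < bcwzCutoff N ε :=
  lt_min hN (Nat.ceil_pos.2 hε)

/-- The ceiling adds at most `1 ≤ δ⁻¹ lg ε⁻¹`. This is why the constant depends on `ε₀`. -/
theorem bcwzCutoff_le {N : ℕ} {ε δ : ℝ} (hδ : 0 < δ) (hε : δ ≤ Real.logb 2 ε⁻¹) :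
    (bcwzCutoff N ε : ℝ) ≤ (1 + δ⁻¹) * Real.logb 2 ε⁻¹ := by
  have h1 : (bcwzCutoff N ε : ℝ) ≤ ⌈Real.logb 2 ε⁻¹⌉₊ := by exact_mod_cast min_le_right _ _
  have h2 := Nat.ceil_lt_add_one (hδ.le.trans hε)
  have h3 : 1 ≤ δ⁻¹ * Real.logb 2 ε⁻¹ := by
    rw [← div_eq_inv_mul, one_le_div hδ]
    exact hε
  linarith

theorem sqrt_mul_le_of_le_mul {N a b c : ℝ} (hN : 0 ≤ N) (hc : 1 ≤ c) (h : a ≤ c * b) :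
    √(N * a) ≤ c * √(N * b) := by
  have hc0 : 0 ≤ c := by linarith
  calc √(N * a) ≤ √(c ^ 2 * (N * b)) := by
        rcases le_or_gt a 0 with ha | ha
        · rw [Real.sqrt_eq_zero_of_nonpos (mul_nonpos_of_nonneg_of_nonpos hN ha)]
          positivity
        · have hb : 0 ≤ b := by
            by_contra! hb
            nlinarith
          refine Real.sqrt_le_sqrt ?_
          calc N * a ≤ N * (c * b) := by gcongr
            _ ≤ N * (c * b) * c := le_mul_of_one_le_right (by positivity) hc
            _ = c ^ 2 * (N * b) := by ring
    _ = c * √(N * b) := by rw [Real.sqrt_mul (by positivity), Real.sqrt_sq hc0]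

end QuantumSearch

theorem theorem1 (ε₀ : ℝ) (hε₀ : 0 < ε₀) (hε₀' : ε₀ < 1) :
    ∃ C : ℝ, 0 < C ∧
      ∀ (α : Type*) [Fintype α] [Nonempty α] (F : α → Bool) (N M : ℕ) (ε : ℝ),
        N = Fintype.card α → M = QuantumSearch.numSolutions F → 0 < ε → ε ≤ ε₀ →
        (∀ r ∈ (QuantumSearch.findsolLaw F ε).support, ∀ x, r.1 = some x → F x = true) ∧
        (0 < M →
          QuantumSearch.expectedCalls (QuantumSearch.findsolLaw F ε) ≤
            ENNReal.ofReal (C * (√((N : ℝ) / M) +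
              √(N * Real.logb 2 ε⁻¹) * (M : ℝ) ^ (-1.86 : ℝ))) ∧
          QuantumSearch.probResult (QuantumSearch.findsolLaw F ε) none <
            ENNReal.ofReal (0.5 * (M : ℝ) ^ (-1.86 : ℝ) * ε) ∧
          (∀ x y, F x = true → F y = true →
            QuantumSearch.probResult (QuantumSearch.findsolLaw F ε) (some x) =
              QuantumSearch.probResult (QuantumSearch.findsolLaw F ε) (some y))) ∧
        (M = 0 →
          QuantumSearch.probResult (QuantumSearch.findsolLaw F ε) none = 1 ∧
          QuantumSearch.expectedCalls (QuantumSearch.findsolLaw F ε) ≤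
            ENNReal.ofReal (C * √(N * Real.logb 2 ε⁻¹))) ∧
        (∀ r ∈ (QuantumSearch.findsolLaw F ε).support, r.1 = none →
          (r.2 : ℝ) ≤ C * √(N * Real.logb 2 ε⁻¹)) := by
  have hδ : 0 < Real.logb 2 ε₀⁻¹ := Real.logb_pos one_lt_two ((one_lt_inv₀ hε₀).2 hε₀')
  set δ := Real.logb 2 ε₀⁻¹ with hδ_def
  set κ := 1 + δ⁻¹ with hκ
  have hκ1 : 1 ≤ κ := by
    have : 0 < δ⁻¹ := inv_pos.2 hδ
    linarith
  -- The `320` comes from two BBHT runs in expectation. The `48 = 36 + 12` comes from the worst case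
  -- of two BBHT runs and BCWZ, each square root costing a factor `κ`.
  refine ⟨320 + 48 * κ, by linarith, ?_⟩
  intro α _ _ F N M ε hN hM hε hεle
  have hδε : δ ≤ Real.logb 2 ε⁻¹ := by
    rw [hδ_def]
    refine Real.logb_le_logb_of_le one_lt_two (by positivity) ?_
    gcongr
  have ht : 0 < QuantumSearch.bcwzCutoff (Fintype.card α) ε :=
    QuantumSearch.bcwzCutoff_pos Fintype.card_pos (hδ.trans_le hδε)
  have hS : √((Fintype.card α : ℝ) * QuantumSearch.bcwzCutoff (Fintype.card α) ε) ≤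
      κ * √(N * Real.logb 2 ε⁻¹) := by
    rw [hN]
    exact QuantumSearch.sqrt_mul_le_of_le_mul (by positivity) hκ1
      (QuantumSearch.bcwzCutoff_le hδ hδε)
  -- The worst-case cost of BBHT is of order `√N` without a logarithm; it is absorbed because `1 ≤ κ
  -- lg ε⁻¹`.
  have hT : √((Fintype.card α : ℝ) * 1) ≤ κ * √(N * Real.logb 2 ε⁻¹) := by
    rw [hN]
    refine QuantumSearch.sqrt_mul_le_of_le_mul (by positivity) hκ1 ?_
    have h3 : 1 ≤ δ⁻¹ * Real.logb 2 ε⁻¹ := by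
      rw [← div_eq_inv_mul, one_le_div hδ]
      exact hδε
    rw [hκ]
    linarith
  rw [mul_one] at hT
  have hnn : 0 ≤ √(N * Real.logb 2 ε⁻¹) := Real.sqrt_nonneg _
  have hcalls : QuantumSearch.CallsLE F (QuantumSearch.findsol α ε)
      ((320 + 48 * κ) * √(N * Real.logb 2 ε⁻¹)) :=
    (QuantumSearch.CallsLE.findsol ht).mono (by linarith)
  refine ⟨QuantumSearch.Sound.findsol ε, fun hM0 => ?_, fun hM0 => ?_,
    fun r hr _ => hcalls r hr⟩
  · subst hM
    refine ⟨(QuantumSearch.expectedCalls_findsol_le ht hM0).trans (ENNReal.ofReal_le_ofReal ?_),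
      QuantumSearch.failProb_findsol_lt hε ht hM0, QuantumSearch.Fair.findsol ε⟩
    rw [← hN] at hS ⊢
    have hp : 0 ≤ (QuantumSearch.numSolutions F : ℝ) ^ (-1.86 : ℝ) := by positivity
    have hq : 0 ≤ √((N : ℝ) / QuantumSearch.numSolutions F) := Real.sqrt_nonneg _
    have h1 := mul_le_mul_of_nonneg_right hS hp
    have h2 : 0 ≤ √(N * Real.logb 2 ε⁻¹) * (QuantumSearch.numSolutions F : ℝ) ^ (-1.86 : ℝ) :=
      mul_nonneg hnn hp
    have h3 : 0 ≤ κ * √((N : ℝ) / QuantumSearch.numSolutions F) := by positivity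
    have h4 : 0 ≤ κ * (√(N * Real.logb 2 ε⁻¹) *
      (QuantumSearch.numSolutions F : ℝ) ^ (-1.86 : ℝ)) := mul_nonneg (by linarith) h2
    linarith
  · refine ⟨(QuantumSearch.Sound.findsol ε).failProb_eq_one fun x => ?_, hcalls.expectedCalls_le⟩
    have h := Finset.card_eq_zero.1 (hM.symm.trans hM0)
    simpa using Finset.filter_eq_empty_iff.1 h (Finset.mem_univ x)
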